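/- A \emph{ternary group} is a non-empty set $X$ with an operation $[\ ]\colon X^3\to X$ satisfying $[[abc]de]=[a[bcd]e]=[ab[cde]]$ and such that in $[abc]=d$ any three of the elements $a,b,c,d$ determine the fourth uniquely; the skew element $\bar a$ is the unique solution $x$ of $[aax]=a$. A ternary group can be given by generators and relations in the usual way (words in the generators formed with $[\ ]$ and $\bar{\ }$, modulo the congruence generated by the laws of ternary groups and the given relations). Let $D$ be a classical knot diagram. \begin{itemize} \item The \emph{ternary knot group} $\pi_1^T(D)$ is the ternary group with one generator for each region in the complement of $D$ and one relation $d=[a\bar b c]$ for each crossing, where $d,a,b,c$ are the generators of the four regions met in cyclic order around the crossing, $d$ and $a$ being separated by the under-strand. \item Orient $D$. The \emph{Wirtinger-type ternary group} $T\Pi_D$ is the ternary group with one generator for each arc of $D$ (from undercrossing to undercrossing) and one relation $x_i=[\bar x_j x_k x_j]$ for each crossing, where $x_j$ is the over-arc, and $x_i$, $x_k$ are the under-arcs to the left and to the right of the over-arc, respectively. \end{itemize} If $D$ and $D'$ are diagrams of the same (unoriented) knot, that is, if they are connected by a finite sequence of isotopies of diagrams on the sphere and Reidemeister moves (of all three types,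 with all signs and orientations) and reversals of orientation, then $\pi_1^T(D)\cong\pi_1^T(D')$ and $T\Pi_D\cong T\Pi_{D'}$ as ternary groups. -/

import Mathlib

namespace TernaryKnot

/-! ### Ternary groups -/

/-- A ternary group: a non-empty set with a ternary operation which is associative and such that in
`[a b c] = d` any three of the four elements determine the remaining one uniquely. -/
class TernaryGroup (X : Type*) where
  op : X → X → X → X
  nonempty : Nonempty X
  assoc_left : ∀ a b c d e : X, op (op a b c) d e = op a (op b c d) e
  assoc_right : ∀ a b c d e : X, op a (op b c d) e = op a b (op c d e)
  solve_fst : ∀ b c d : X, ∃! a, op a b c = d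
  solve_snd : ∀ a c d : X, ∃! b, op a b c = d
  solve_trd : ∀ a b d : X, ∃! c, op a b c = d

/-- The skew element of `a`: the unique solution `x` of `[a a x] = a`. -/
noncomputable def skew {X : Type*} [TernaryGroup X] (a : X) : X :=
  (TernaryGroup.solve_trd a a a).choose

/-- Isomorphisms of ternary groups. -/
structure TernaryIso (X Y : Type*) [TernaryGroup X] [TernaryGroup Y] extends X ≃ Y where
  map_op : ∀ a b c : X,
    toFun (TernaryGroup.op a b c) = TernaryGroup.op (toFun a) (toFun b) (toFun c)

/-! ### Ternary groups given by generators and relations -/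

/-- Formal words in the generators `S`, built with the ternary bracket and the bar (skew). -/
inductive TWord (S : Type*) where
  | gen (s : S) : TWord S
  | op (a b c : TWord S) : TWord S
  | bar (a : TWord S) : TWord S

/-- The congruence on words generated by the relations `R` and the laws of ternary groups
(associativity and the laws of skew elements). -/
inductive TWord.Rel {S : Type*} (R : Set (TWord S × TWord S)) : TWord S → TWord S → Prop where
  | of {a b : TWord S} : (a, b) ∈ R → Rel R a b
  | refl (a : TWord S) : Rel R a a
  | symm {a b : TWord S} : Rel R a b → Rel R b a
  | trans {a b c : TWord S} : Rel R a b → Rel R b c → Rel R a c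
  | op_congr {a a' b b' c c' : TWord S} :
      Rel R a a' → Rel R b b' → Rel R c c' → Rel R (.op a b c) (.op a' b' c')
  | bar_congr {a a' : TWord S} : Rel R a a' → Rel R (.bar a) (.bar a')
  | assoc_left (a b c d e : TWord S) : Rel R (.op (.op a b c) d e) (.op a (.op b c d) e)
  | assoc_right (a b c d e : TWord S) : Rel R (.op a (.op b c d) e) (.op a b (.op c d e))
  | right_mul_bar (a b : TWord S) : Rel R (.op b a (.bar a)) b
  | right_bar_mul (a b : TWord S) : Rel R (.op b (.bar a) a) b
  | left_mul_bar (a b : TWord S) : Rel R (.op a (.bar a) b) b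
  | left_bar_mul (a b : TWord S) : Rel R (.op (.bar a) a b) b

def TWord.setoid {S : Type*} (R : Set (TWord S × TWord S)) : Setoid (TWord S) where
  r := TWord.Rel R
  iseqv := ⟨.refl, .symm, .trans⟩

/-- The ternary group presented by the generators `S` and the relations `R`. -/
def Presented {S : Type*} (R : Set (TWord S × TWord S)) : Type _ :=
  Quotient (TWord.setoid R)

namespace Presented

variable {S : Type*} {R : Set (TWord S × TWord S)}

def mk (a : TWord S) : Presented R := Quotient.mk (TWord.setoid R) a

def op : Presented R → Presented R → Presented R → Presented R := fun x y z =>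
  Quotient.liftOn x
    (fun a => Quotient.liftOn₂ y z (fun b c => (mk (.op a b c) : Presented R))
      (fun _ _ _ _ h₁ h₂ => Quotient.sound (.op_congr (.refl _) h₁ h₂)))
    (fun _ _ h => Quotient.inductionOn₂ y z
      (fun b c => Quotient.sound (.op_congr h (.refl b) (.refl c))))

def bar : Presented R → Presented R :=
  Quotient.map' TWord.bar (fun _ _ h => .bar_congr h)

theorem op_assoc_left (a b c d e : Presented R) :
    op (op a b c) d e = op a (op b c d) e := by
  induction a using Quotient.ind
  induction b using Quotient.ind
  induction c using Quotient.ind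
  induction d using Quotient.ind
  induction e using Quotient.ind
  exact Quotient.sound (.assoc_left _ _ _ _ _)

theorem op_assoc_right (a b c d e : Presented R) :
    op a (op b c d) e = op a b (op c d e) := by
  induction a using Quotient.ind
  induction b using Quotient.ind
  induction c using Quotient.ind
  induction d using Quotient.ind
  induction e using Quotient.ind
  exact Quotient.sound (.assoc_right _ _ _ _ _)

theorem right_mul_bar (a b : Presented R) : op b a (bar a) = b := by
  induction a using Quotient.ind
  induction b using Quotient.ind
  exact Quotient.sound (.right_mul_bar _ _)

theorem right_bar_mul (a b : Presented R) : op b (bar a) a = b := by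
  induction a using Quotient.ind
  induction b using Quotient.ind
  exact Quotient.sound (.right_bar_mul _ _)

theorem left_mul_bar (a b : Presented R) : op a (bar a) b = b := by
  induction a using Quotient.ind
  induction b using Quotient.ind
  exact Quotient.sound (.left_mul_bar _ _)

theorem left_bar_mul (a b : Presented R) : op (bar a) a b = b := by
  induction a using Quotient.ind
  induction b using Quotient.ind
  exact Quotient.sound (.left_bar_mul _ _)

instance instTernaryGroup [Nonempty S] : TernaryGroup (Presented R) where
  op := op
  nonempty := ⟨mk (.gen (Classical.arbitrary S))⟩
  assoc_left := op_assoc_left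
  assoc_right := op_assoc_right
  solve_fst b c d := by
    refine ⟨op d (bar c) (bar b), ?_, ?_⟩
    · show op (op d (bar c) (bar b)) b c = d
      rw [op_assoc_left, right_bar_mul, right_bar_mul]
    · rintro a rfl
      rw [op_assoc_left, op_assoc_right, left_mul_bar, right_mul_bar]
  solve_snd a c d := by
    refine ⟨op (bar a) d (bar c), ?_, ?_⟩
    · show op a (op (bar a) d (bar c)) c = d
      rw [← op_assoc_left, left_mul_bar, right_bar_mul]
    · rintro b rfl
      rw [← op_assoc_left, left_bar_mul, right_mul_bar]
  solve_trd a b d := by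
    refine ⟨op (bar b) (bar a) d, ?_, ?_⟩
    · show op a b (op (bar b) (bar a) d) = d
      rw [← op_assoc_right, left_mul_bar, left_mul_bar]
    · rintro c rfl
      rw [← op_assoc_right, left_bar_mul, left_bar_mul]

/-- In a presented ternary group the formal bar is the skew element. -/
theorem skew_mk [Nonempty S] (a : TWord S) :
    skew (mk a : Presented R) = mk (.bar a) :=
  (TernaryGroup.solve_trd (mk a : Presented R) (mk a) (mk a)).unique
    (TernaryGroup.solve_trd (mk a : Presented R) (mk a) (mk a)).choose_spec.1
    (right_mul_bar (mk a) (mk a))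

end Presented

/-! ### Knot diagrams

An oriented knot diagram is recorded, up to isotopy of the sphere, by its planar diagram code.  The
edges are labelled by natural numbers.  A pair `(i, j)` stands for a passage of the knot through a
vertex, coming in along the edge `i` and going out along the edge `j`.  Two-valent vertices
(`joint`) are allowed: they only subdivide an edge, and they provide the diagram without crossings,
which is a circle with one joint `(i, i)`. -/

/-- Vertices of a diagram: joints, and crossings given by their sign, the passage of the upper
strand and the passage of the lower strand.  At a crossing of sign `1` (positive) the lower strand
goes from the right to the left of the upper strand, at a crossing of sign `-1` (negative) it goes
from the left to the right. -/
inductive Vertex where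
  | joint (p : ℕ × ℕ) : Vertex
  | crossing (sign : ℤˣ) (upper lower : ℕ × ℕ) : Vertex

namespace Vertex

def passes : Vertex → Multiset (ℕ × ℕ)
  | joint p => {p}
  | crossing _ o u => {o, u}

def isCrossing : Vertex → Bool
  | joint _ => false
  | crossing _ _ _ => true

/-- Change of edge labels. -/
def relabel (f : ℕ → ℕ) : Vertex → Vertex
  | joint p => joint (p.map f f)
  | crossing s o u => crossing s (o.map f f) (u.map f f)

/-- The same vertex of the diagram with the reversed orientation. -/
def reverse : Vertex → Vertex
  | joint p => joint p.swap
  | crossing s o u => crossing s o.swap u.swap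

/-- A side of an edge is a pair `(i, ε)`: the left side of the edge `i` for `ε = 1`, its right side
for `ε = -1`.  `v.Adj x y` says that near the vertex `v` the sides `x` and `y` are joined by a corner
of a region.  A joint has two corners and a crossing has four. -/
inductive Adj : Vertex → ℕ × ℤˣ → ℕ × ℤˣ → Prop where
  | joint (p : ℕ × ℕ) (ε : ℤˣ) : Adj (joint p) (p.1, ε) (p.2, ε)
  | in_in (s : ℤˣ) (o u : ℕ × ℕ) : Adj (crossing s o u) (o.1, -s) (u.1, s)
  | in_out (s : ℤˣ) (o u : ℕ × ℕ) : Adj (crossing s o u) (o.1, s) (u.2, s)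
  | out_in (s : ℤˣ) (o u : ℕ × ℕ) : Adj (crossing s o u) (o.2, -s) (u.1, -s)
  | out_out (s : ℤˣ) (o u : ℕ × ℕ) : Adj (crossing s o u) (o.2, s) (u.2, -s)

end Vertex

/-- Codes of diagrams: finite collections of vertices. -/
abbrev Code := Multiset Vertex

namespace Code

def passes (D : Code) : Multiset (ℕ × ℕ) := D.bind Vertex.passes

def ins (D : Code) : Multiset ℕ := D.passes.map Prod.fst

def outs (D : Code) : Multiset ℕ := D.passes.map Prod.snd

/-- The edges of a diagram. -/
def Edge (D : Code) : Type := {i : ℕ // i ∈ D.ins}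

def numCrossings (D : Code) : ℕ := D.countP (fun v => v.isCrossing = true)

/-- The regions in the complement of the diagram: classes of sides of edges under the equivalence
relation generated by having a common corner. -/
def Region (D : Code) : Type :=
  Quot (fun x y : D.Edge × ℤˣ => ∃ v ∈ D, v.Adj (x.1.1, x.2) (y.1.1, y.2))

/-- The region on the left (`ε = 1`) or on the right (`ε = -1`) of an edge. -/
def region (D : Code) (i : D.Edge) (ε : ℤˣ) : D.Region := Quot.mk _ (i, ε)

/-- The arcs of the diagram (running from undercrossing to undercrossing): classes of edges under
the equivalence relation generated by passing through a joint or passing over a crossing. -/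
def Arc (D : Code) : Type :=
  Quot (fun i j : D.Edge =>
    Vertex.joint (i.1, j.1) ∈ D ∨ ∃ s u, Vertex.crossing s (i.1, j.1) u ∈ D)

/-- The arc containing an edge. -/
def arc (D : Code) (i : D.Edge) : D.Arc := Quot.mk _ i

/-- A code is that of a knot diagram on the sphere: every edge comes into exactly one vertex and goes
out of exactly one vertex, all edges are traversed by one closed curve, and the surface obtained by
gluing a disc to every region is a sphere.  (The number of edges minus the number of vertices is the
number of crossings, so Euler characteristic `2` means that there are two more regions than
crossings.) -/
structure IsKnot (D : Code) : Prop where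
  ne_zero : D ≠ 0
  nodup : D.ins.Nodup
  outs_eq : D.outs = D.ins
  one_component : ∀ i ∈ D.ins, ∀ j ∈ D.ins,
    Relation.ReflTransGen (fun a b => (a, b) ∈ D.passes) i j
  spherical : Nat.card D.Region = D.numCrossings + 2

end Code

/-- An (oriented) knot diagram. -/
structure KnotDiagram where
  code : Code
  isKnot : code.IsKnot

theorem Code.exists_mem_ins {D : Code} (h : D ≠ 0) : ∃ i, i ∈ D.ins := by
  obtain ⟨v, hv⟩ := Multiset.exists_mem_of_ne_zero h
  cases v with
  | joint p =>
    exact ⟨p.1, Multiset.mem_map_of_mem _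
      (Multiset.mem_bind.2 ⟨_, hv, by simp [Vertex.passes]⟩)⟩
  | crossing s o u =>
    exact ⟨o.1, Multiset.mem_map_of_mem _
      (Multiset.mem_bind.2 ⟨_, hv, by simp [Vertex.passes]⟩)⟩

instance KnotDiagram.nonempty_region (D : KnotDiagram) : Nonempty D.code.Region :=
  let ⟨i, hi⟩ := Code.exists_mem_ins D.isKnot.ne_zero
  ⟨D.code.region ⟨i, hi⟩ 1⟩

instance KnotDiagram.nonempty_arc (D : KnotDiagram) : Nonempty D.code.Arc :=
  let ⟨i, hi⟩ := Code.exists_mem_ins D.isKnot.ne_zero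
  ⟨D.code.arc ⟨i, hi⟩⟩

/-! ### Reidemeister moves -/

/-- A strand made of three consecutive edges `x.1`, `x.2.1`, `x.2.2` passes through two crossings.
This is its passage through the first of them for `t = 1`, through the second one for `t = -1`. -/
def segment (t : ℤˣ) (x : ℕ × ℕ × ℕ) : ℕ × ℕ :=
  if t = 1 then (x.1, x.2.1) else (x.2.1, x.2.2)

/-- A bigon: an upper strand `o` and a lower strand `u` crossing twice, with opposite signs.  The
lower strand meets the first crossing of the upper strand first if `t = 1`, last if `t = -1`. -/
def bigon (s t : ℤˣ) (o u : ℕ × ℕ × ℕ) : Code :=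
  {.crossing s (segment 1 o) (segment t u), .crossing (-s) (segment (-1) o) (segment (-t) u)}

/-- A triangle bounded by a top strand `x`, a middle strand `y` and a bottom strand `z`.  Here
`a = 1` iff `x` meets `y` before `z`, `b = 1` iff `y` meets `x` before `z`, `c = 1` iff `z` meets `x`
before `y`.  For `κ = 1` the top, bottom and middle strand bound the triangle in this
counterclockwise order, for `κ = -1` in this clockwise order. -/
def triangle (κ a b c : ℤˣ) (x y z : ℕ × ℕ × ℕ) : Code :=
  {.crossing (κ * a * b) (segment a x) (segment b y),
   .crossing (κ * a * c) (segment (-a) x) (segment c z),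
   .crossing (κ * b * c) (segment (-b) y) (segment (-c) z)}

/-- The elementary changes of diagrams: renaming edges, removing a joint, reversing the orientation
(knots are considered without orientation), and the three Reidemeister moves, with all
orientations and signs.  Here `L` is the part of the diagram which does not change. -/
inductive Move : Code → Code → Prop where
  | relabel (f : ℕ → ℕ) (hf : Function.Injective f) (L : Code) :
      Move L (L.map (Vertex.relabel f))
  | remove_joint (i j : ℕ) (hij : i ≠ j) (L : Code) :
      Move (.joint (i, j) ::ₘ L) (L.map (Vertex.relabel (Function.update id j i)))
  | reverse (L : Code) : Move L (L.map Vertex.reverse)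
  | reidemeister₁_over (s : ℤˣ) (i j k : ℕ) (L : Code) :
      Move (.crossing s (i, j) (j, k) ::ₘ L) (.joint (i, k) ::ₘ L)
  | reidemeister₁_under (s : ℤˣ) (i j k : ℕ) (L : Code) :
      Move (.crossing s (j, k) (i, j) ::ₘ L) (.joint (i, k) ::ₘ L)
  | reidemeister₂ (s t : ℤˣ) (o u : ℕ × ℕ × ℕ) (L : Code) :
      Move (bigon s t o u + L) (.joint (o.1, o.2.2) ::ₘ .joint (u.1, u.2.2) ::ₘ L)
  | reidemeister₃ (κ a b c : ℤˣ) (x y z : ℕ × ℕ × ℕ) (L : Code) :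
      Move (triangle κ a b c x y z + L) (triangle κ (-a) (-b) (-c) x y z + L)

/-- Two diagrams represent the same knot: they are connected by a finite sequence of knot diagrams
in which any two neighbours differ by a move (in either direction). -/
def SameKnot : KnotDiagram → KnotDiagram → Prop :=
  Relation.EqvGen (fun D D' => Move D.code D'.code)

/-! ### The two ternary groups of a diagram -/

open TWord in
/-- The relations `d = [a b̄ c]`, one for each crossing, where `d, a, b, c` are the four regions
around the crossing in cyclic order, `d` and `a` being separated by the lower strand.  (If the upper
strand goes from the edge `i` to the edge `j`, these are the region on the left of `i`, on the left
of `j`, on the right of `j` and on the right of `i`.) -/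
def dehnRelations (D : Code) : Set (TWord D.Region × TWord D.Region) :=
  {r | ∃ (s : ℤˣ) (u : ℕ × ℕ) (i j : D.Edge), Vertex.crossing s (i.1, j.1) u ∈ D ∧
    r = (gen (D.region i 1),
      op (gen (D.region j 1)) (bar (gen (D.region j (-1)))) (gen (D.region i (-1))))}

open TWord in
/-- The relations `xᵢ = [x̄ⱼ xₖ xⱼ]`, one for each crossing, where `xⱼ` is the upper arc, `xᵢ` the
lower arc on its left and `xₖ` the lower arc on its right. -/
def wirtingerRelations (D : Code) : Set (TWord D.Arc × TWord D.Arc) :=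
  {r | ∃ i j j' k : D.Edge,
    (Vertex.crossing 1 (j.1, j'.1) (k.1, i.1) ∈ D ∨
      Vertex.crossing (-1) (j.1, j'.1) (i.1, k.1) ∈ D) ∧
    r = (gen (D.arc i), op (bar (gen (D.arc j))) (gen (D.arc k)) (gen (D.arc j)))}

/-- The ternary knot group: one generator per region. -/
abbrev KnotDiagram.dehnTernaryGroup (D : KnotDiagram) : Type :=
  Presented (dehnRelations D.code)

/-- The Wirtinger-type ternary group: one generator per arc. -/
abbrev KnotDiagram.wirtingerTernaryGroup (D : KnotDiagram) : Type :=
  Presented (wirtingerRelations D.code)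

end TernaryKnot

/-! Both groups are treated through the functors they represent. A coloring of a diagram by a
ternary group `G` gives each edge either one element of `G` (Wirtinger) or one for each of its two
sides (Dehn), subject to conditions at the vertices. Homomorphisms from the presented group to `G`
are the same as colorings by `G` (`represents_wirtinger`, `represents_dehn`). If a move induces a
bijection of colorings natural in `G`, the Yoneda argument `Correspondence.nonempty_iso` makes the
two groups isomorphic.

What the moves need is collected in `KnotRule`: a crossing can be read backwards, either strand can
be reversed (skew of the color, respectively exchange of the sides), incoming colors determine
outgoing ones, and there are existence conditions for a loop and for one triangle. Reversing strands
reduces all oriented third moves to that triangle. In it, the Wirtinger rule comes down to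
conjugation being an automorphism, and the Dehn rule to eliminating the color of the old triangle
and solving for that of the new one.

Only the creation of a bigon is not local: for Dehn colorings the facing sides of the two strands
must carry the same color. The code does not say that they bound a common region; this comes from
the sphericity of both diagrams by counting regions (`region_eq_of_bigon`). -/

namespace TernaryKnot

/-! ### Calculations in ternary groups -/

namespace TernaryGroup

variable {X : Type*} [TernaryGroup X]

theorem op_skew_self (a : X) : op a a (skew a) = a :=
  (solve_trd a a a).choose_spec.1

theorem op_left_injective {a b c c' : X} (h : op a b c = op a b c') : c = c' :=
  (solve_trd a b (op a b c')).unique h rfl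

theorem op_middle_injective {a b b' c : X} (h : op a b c = op a b' c) : b = b' :=
  (solve_snd a c (op a b' c)).unique h rfl

theorem op_right_injective {a a' b c : X} (h : op a b c = op a' b c) : a = a' :=
  (solve_fst b c (op a' b c)).unique h rfl

-- Together with `op_op_middle` this moves all brackets to the right, the normal form in which
-- `simp` then cancels an element against a neighboring skew.
@[simp] theorem op_op_left (a b c d e : X) : op (op a b c) d e = op a b (op c d e) := by
  rw [assoc_left, assoc_right]

@[simp] theorem op_op_middle (a b c d e : X) : op a (op b c d) e = op a b (op c d e) :=
  assoc_right a b c d e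

-- Writing `b` as `[c a a]` reduces this to `[a a ā] = a`. The three companions follow by cancelling
-- a common factor; together they are the skew laws imposed on words in `TWord.Rel`.
@[simp] theorem right_mul_skew (a b : X) : op b a (skew a) = b := by
  obtain ⟨c, rfl, -⟩ := solve_fst a a b
  rw [op_op_left, op_skew_self]

@[simp] theorem left_mul_skew (a b : X) : op a (skew a) b = b := by
  refine op_left_injective (a := a) (b := a) ?_
  rw [← op_op_middle, right_mul_skew]

@[simp] theorem right_skew_mul (a b : X) : op b (skew a) a = b := by
  refine op_right_injective (b := skew a) (c := a) ?_
  rw [op_op_left, left_mul_skew]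

@[simp] theorem left_skew_mul (a b : X) : op (skew a) a b = b := by
  refine op_middle_injective (a := a) (c := a) ?_
  rw [op_op_middle, left_mul_skew]

theorem eq_skew {a b x : X} (h : op b a x = b) : x = skew a :=
  op_left_injective (a := b) (b := a) (h.trans (right_mul_skew a b).symm)

@[simp] theorem op_mul_skew_op (a b c d : X) : op a b (op (skew b) c d) = op a c d := by
  rw [← op_op_middle, left_mul_skew]

@[simp] theorem op_skew_mul_op (a b c d : X) : op a (skew b) (op b c d) = op a c d := by
  rw [← op_op_middle, left_skew_mul]

@[simp] theorem skew_skew (a : X) : skew (skew a) = a :=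
  (eq_skew (right_skew_mul a a)).symm

@[simp] theorem skew_op (a b c : X) : skew (op a b c) = op (skew c) (skew b) (skew a) :=
  (eq_skew (b := a) (by simp)).symm

end TernaryGroup

open TernaryGroup (op)

/-! ### Homomorphisms -/

/-- Maps which respect the ternary operation. -/
def IsTernaryHom {X Y : Type*} [TernaryGroup X] [TernaryGroup Y] (f : X → Y) : Prop :=
  ∀ a b c, f (op a b c) = op (f a) (f b) (f c)

theorem IsTernaryHom.map_skew {X Y : Type*} [TernaryGroup X] [TernaryGroup Y] {f : X → Y}
    (hf : IsTernaryHom f) (a : X) : f (skew a) = skew (f a) :=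
  TernaryGroup.eq_skew (b := f a) (by rw [← hf, TernaryGroup.right_mul_skew])

theorem IsTernaryHom.comp {X Y Z : Type*} [TernaryGroup X] [TernaryGroup Y] [TernaryGroup Z]
    {g : Y → Z} {f : X → Y} (hg : IsTernaryHom g) (hf : IsTernaryHom f) :
    IsTernaryHom (g ∘ f) := fun a b c => by simp [hf a b c, hg _ _ _]

/-- The value of a word after a substitution of the generators. -/
noncomputable def TWord.eval {S G : Type*} [TernaryGroup G] (φ : S → G) : TWord S → G
  | .gen s => φ s
  | .op a b c => TernaryGroup.op (a.eval φ) (b.eval φ) (c.eval φ)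
  | .bar a => skew (a.eval φ)

theorem TWord.Rel.eval_eq {S G : Type*} [TernaryGroup G] {φ : S → G}
    {R : Set (TWord S × TWord S)} (hR : ∀ r ∈ R, r.1.eval φ = r.2.eval φ) {a b : TWord S}
    (h : TWord.Rel R a b) : a.eval φ = b.eval φ := by
  induction h with
  | of h => exact hR _ h
  | refl => rfl
  | symm _ ih => exact ih.symm
  | trans _ _ ih₁ ih₂ => exact ih₁.trans ih₂
  | op_congr _ _ _ ih₁ ih₂ ih₃ => simp only [TWord.eval, ih₁, ih₂, ih₃]
  | bar_congr _ ih => simp only [TWord.eval, ih]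
  | _ => simp [TWord.eval]

namespace Presented

variable {S : Type*} [Nonempty S] {R : Set (TWord S × TWord S)}

theorem op_mk (a b c : TWord S) :
    TernaryGroup.op (mk a : Presented R) (mk b) (mk c) = mk (.op a b c) := rfl

theorem exists_lift {G : Type*} [TernaryGroup G] (φ : S → G)
    (hR : ∀ r ∈ R, r.1.eval φ = r.2.eval φ) :
    ∃ h : Presented R → G, IsTernaryHom h ∧ ∀ s, h (mk (.gen s)) = φ s := by
  refine ⟨Quotient.lift (TWord.eval φ) fun a b h => TWord.Rel.eval_eq hR h, ?_, fun s => rfl⟩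
  intro a b c
  induction a using Quotient.ind
  induction b using Quotient.ind
  induction c using Quotient.ind
  rfl

theorem hom_ext {G : Type*} [TernaryGroup G] {f g : Presented R → G} (hf : IsTernaryHom f)
    (hg : IsTernaryHom g) (h : ∀ s, f (mk (.gen s)) = g (mk (.gen s))) : f = g := by
  funext x
  induction x using Quotient.ind with | _ a
  change f (mk a) = g (mk a)
  induction a with
  | gen s => exact h s
  | op a b c iha ihb ihc => rw [← op_mk, hf, hg, iha, ihb, ihc]
  | bar a ih => rw [← skew_mk, hf.map_skew, hg.map_skew, ih]

end Presented

/-! ### Colorings of diagrams -/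

/-- A rule for colorings of diagrams by elements of ternary groups: the condition at a crossing of
given sign, on the colors of the incoming and outgoing upper edge and of the incoming and outgoing
lower edge.  An edge has one color for every element of `Λ`. -/
structure CrossingRule (Λ : Type) where
  Rel : ∀ {G : Type} [TernaryGroup G], ℤˣ → (Λ → G) → (Λ → G) → (Λ → G) → (Λ → G) → Prop
  map : ∀ {G H : Type} [TernaryGroup G] [TernaryGroup H] {f : G → H}, IsTernaryHom f →
    ∀ {s : ℤˣ} {x x' y y' : Λ → G}, Rel s x x' y y' → Rel s (f ∘ x) (f ∘ x') (f ∘ y) (f ∘ y')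

namespace CrossingRule

variable {Λ : Type} (C : CrossingRule Λ) {G H : Type} [TernaryGroup G] [TernaryGroup H]

/-- The condition on a coloring at a vertex. -/
def Compat (c : ℕ → Λ → G) : Vertex → Prop
  | .joint p => c p.1 = c p.2
  | .crossing s o u => C.Rel s (c o.1) (c o.2) (c u.1) (c u.2)

/-- Colorings of a code. -/
def Coloring (D : Code) (c : ℕ → Λ → G) : Prop := ∀ v ∈ D, C.Compat c v

variable {C}

theorem Coloring.map {D : Code} {c : ℕ → Λ → G} (hc : C.Coloring D c) {f : G → H}
    (hf : IsTernaryHom f) : C.Coloring D (fun i => f ∘ c i) := by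
  intro v hv
  have := hc v hv
  cases v with
  | joint p => exact congrArg (f ∘ ·) this
  | crossing s o u => exact C.map hf this

theorem compat_relabel {c : ℕ → Λ → G} (f : ℕ → ℕ) (v : Vertex) :
    C.Compat c (v.relabel f) ↔ C.Compat (c ∘ f) v := by
  cases v <;> rfl

theorem coloring_map_relabel {c : ℕ → Λ → G} (f : ℕ → ℕ) (D : Code) :
    C.Coloring (D.map (Vertex.relabel f)) c ↔ C.Coloring D (c ∘ f) := by
  simp [Coloring, compat_relabel]

theorem coloring_add {D E : Code} {c : ℕ → Λ → G} :
    C.Coloring (D + E) c ↔ C.Coloring D c ∧ C.Coloring E c := by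
  simp [Coloring, or_imp, forall_and]

theorem coloring_cons {v : Vertex} {E : Code} {c : ℕ → Λ → G} :
    C.Coloring (v ::ₘ E) c ↔ C.Compat c v ∧ C.Coloring E c := by
  simp [Coloring]

theorem compat_congr {v : Vertex} {c c' : ℕ → Λ → G}
    (h : ∀ p ∈ v.passes, c p.1 = c' p.1 ∧ c p.2 = c' p.2) (hc : C.Compat c v) :
    C.Compat c' v := by
  cases v with
  | joint p =>
    have := h p (by simp [Vertex.passes])
    simpa only [Compat, this] using hc
  | crossing s o u =>
    have h₁ := h o (by simp [Vertex.passes])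
    have h₂ := h u (by simp [Vertex.passes])
    simpa only [Compat, h₁, h₂] using hc

/-- A ternary group represents the colorings of a code if it carries a universal coloring. -/
def Represents (C : CrossingRule Λ) (D : Code) (P : Type) [TernaryGroup P] : Prop :=
  ∃ c : ℕ → Λ → P, C.Coloring D c ∧
    (∀ {G : Type} [TernaryGroup G] (d : ℕ → Λ → G), C.Coloring D d →
      ∃ h : P → G, IsTernaryHom h ∧ ∀ i ∈ D.ins, h ∘ c i = d i) ∧
    ∀ {G : Type} [TernaryGroup G] {f g : P → G}, IsTernaryHom f → IsTernaryHom g →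
      (∀ i ∈ D.ins, f ∘ c i = g ∘ c i) → f = g

/-- A natural correspondence between the colorings of two codes. -/
structure Correspondence (C : CrossingRule Λ) (D D' : Code) where
  Rel : ∀ {G : Type} [TernaryGroup G], (ℕ → Λ → G) → (ℕ → Λ → G) → Prop
  map : ∀ {G H : Type} [TernaryGroup G] [TernaryGroup H] {f : G → H}, IsTernaryHom f →
    ∀ {c c' : ℕ → Λ → G}, Rel c c' → Rel (fun i => f ∘ c i) (fun i => f ∘ c' i)
  exists_right : ∀ {G : Type} [TernaryGroup G] {c : ℕ → Λ → G}, C.Coloring D c →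
    ∃ c', C.Coloring D' c' ∧ Rel c c'
  exists_left : ∀ {G : Type} [TernaryGroup G] {c' : ℕ → Λ → G}, C.Coloring D' c' →
    ∃ c, C.Coloring D c ∧ Rel c c'
  unique_right : ∀ {G : Type} [TernaryGroup G] {c₁ c₂ c₁' c₂' : ℕ → Λ → G}, C.Coloring D c₁ →
    C.Coloring D c₂ → C.Coloring D' c₁' → C.Coloring D' c₂' → Rel c₁ c₁' → Rel c₂ c₂' →
    (∀ i ∈ D.ins, c₁ i = c₂ i) → ∀ i ∈ D'.ins, c₁' i = c₂' i
  unique_left : ∀ {G : Type} [TernaryGroup G] {c₁ c₂ c₁' c₂' : ℕ → Λ → G}, C.Coloring D c₁ →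
    C.Coloring D c₂ → C.Coloring D' c₁' → C.Coloring D' c₂' → Rel c₁ c₁' → Rel c₂ c₂' →
    (∀ i ∈ D'.ins, c₁' i = c₂' i) → ∀ i ∈ D.ins, c₁ i = c₂ i

/-- The Yoneda argument: each universal coloring is transported to the other diagram and induces a
homomorphism there. Naturality and uniqueness of the correspondence show that both composites fix a
universal coloring, hence are identities. -/
theorem Correspondence.nonempty_iso {D D' : Code} (T : C.Correspondence D D') {P P' : Type}
    [TernaryGroup P] [TernaryGroup P'] (hP : C.Represents D P) (hP' : C.Represents D' P') :
    Nonempty (TernaryIso P P') := by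
  obtain ⟨u, hu, lift, ext⟩ := hP
  obtain ⟨u', hu', lift', ext'⟩ := hP'
  obtain ⟨c, hc, hcu⟩ := T.exists_left hu'
  obtain ⟨c', hc', hcu'⟩ := T.exists_right hu
  obtain ⟨f, hf, hfu⟩ := lift c hc
  obtain ⟨g, hg, hgu⟩ := lift' c' hc'
  have h₁ : g ∘ f = id := by
    refine ext (hg.comp hf) (fun _ _ _ => rfl) fun i hi => ?_
    rw [Function.comp_assoc, hfu i hi, Function.id_comp]
    exact T.unique_left (hc.map hg) hu (hu'.map hg) hc' (T.map hg hcu) hcu' hgu i hi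
  have h₂ : f ∘ g = id := by
    refine ext' (hf.comp hg) (fun _ _ _ => rfl) fun i hi => ?_
    rw [Function.comp_assoc, hgu i hi, Function.id_comp]
    exact T.unique_right (hu.map hf) hc (hc'.map hf) hu' (T.map hf hcu') hcu hfu i hi
  exact ⟨⟨⟨f, g, congrFun h₁, congrFun h₂⟩, hf⟩⟩

end CrossingRule

/-! ### Bookkeeping of incoming and outgoing edges -/

namespace Code

theorem fst_mem_ins {D : Code} {v : Vertex} (hv : v ∈ D) {p : ℕ × ℕ} (hp : p ∈ v.passes) :
    p.1 ∈ D.ins :=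
  Multiset.mem_map_of_mem _ (Multiset.mem_bind.2 ⟨v, hv, hp⟩)

theorem snd_mem_outs {D : Code} {v : Vertex} (hv : v ∈ D) {p : ℕ × ℕ} (hp : p ∈ v.passes) :
    p.2 ∈ D.outs :=
  Multiset.mem_map_of_mem _ (Multiset.mem_bind.2 ⟨v, hv, hp⟩)

theorem IsKnot.snd_mem_ins {D : Code} (hD : D.IsKnot) {v : Vertex} (hv : v ∈ D) {p : ℕ × ℕ}
    (hp : p ∈ v.passes) : p.2 ∈ D.ins :=
  hD.outs_eq ▸ snd_mem_outs hv hp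

theorem IsKnot.nodup_outs {D : Code} (hD : D.IsKnot) : D.outs.Nodup := hD.outs_eq ▸ hD.nodup

@[simp] theorem ins_add (D E : Code) : (D + E).ins = D.ins + E.ins := by
  simp [ins, passes]

@[simp] theorem outs_add (D E : Code) : (D + E).outs = D.outs + E.outs := by
  simp [outs, passes]

@[simp] theorem ins_cons (v : Vertex) (D : Code) :
    ins (v ::ₘ D) = v.passes.map Prod.fst + ins D := by
  simp [ins, passes]

@[simp] theorem outs_cons (v : Vertex) (D : Code) :
    outs (v ::ₘ D) = v.passes.map Prod.snd + outs D := by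
  simp [outs, passes]

@[simp] theorem ins_singleton (v : Vertex) :
    ins {v} = v.passes.map Prod.fst := by
  simp [ins, passes]

@[simp] theorem outs_singleton (v : Vertex) :
    outs {v} = v.passes.map Prod.snd := by
  simp [outs, passes]

end Code

theorem Vertex.passes_relabel (f : ℕ → ℕ) (v : Vertex) :
    (v.relabel f).passes = v.passes.map (Prod.map f f) := by
  cases v <;> simp [Vertex.passes, Vertex.relabel]

theorem Vertex.passes_reverse (v : Vertex) : v.reverse.passes = v.passes.map Prod.swap := by
  cases v <;> simp [Vertex.passes, Vertex.reverse]

theorem Code.ins_map_relabel (f : ℕ → ℕ) (D : Code) :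
    Code.ins (D.map (Vertex.relabel f)) = D.ins.map f := by
  simp [Code.ins, Code.passes, Multiset.bind_map, Multiset.map_bind, Vertex.passes_relabel]

theorem Code.ins_map_reverse (D : Code) : Code.ins (D.map Vertex.reverse) = D.outs := by
  simp [Code.ins, Code.outs, Code.passes, Multiset.bind_map, Multiset.map_bind,
    Vertex.passes_reverse]

/-- The passage of a strand with three edges through the first (`t = 1`) or the second (`t = -1`)
of its two crossings. -/
def strandPass {X : Type*} (t : ℤˣ) (x : X × X × X) : X × X :=
  if t = 1 then (x.1, x.2.1) else (x.2.1, x.2.2)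

theorem map_segment {X : Type*} (c : ℕ → X) (t : ℤˣ) (x : ℕ × ℕ × ℕ) :
    (segment t x).map c c = strandPass t (x.map c (Prod.map c c)) := by
  unfold segment strandPass
  split_ifs <;> rfl

/-- Crossing rules for which colorings do not change under the Reidemeister moves, as far as this
can be seen locally. -/
structure KnotRule (Λ : Type) extends CrossingRule Λ where
  rev : ∀ {G : Type} [TernaryGroup G], (Λ → G) → Λ → G
  rev_rev : ∀ {G : Type} [TernaryGroup G] (x : Λ → G), rev (rev x) = x
  comp_rev : ∀ {G H : Type} [TernaryGroup G] [TernaryGroup H] {f : G → H}, IsTernaryHom f →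
    ∀ x : Λ → G, f ∘ rev x = rev (f ∘ x)
  rev_upper : ∀ {G : Type} [TernaryGroup G] {s : ℤˣ} {x x' y y' : Λ → G},
    Rel s x x' y y' → Rel (-s) (rev x') (rev x) y y'
  rev_lower : ∀ {G : Type} [TernaryGroup G] {s : ℤˣ} {x x' y y' : Λ → G},
    Rel s x x' y y' → Rel (-s) x x' (rev y') (rev y)
  symm : ∀ {G : Type} [TernaryGroup G] {s : ℤˣ} {x x' y y' : Λ → G},
    Rel s x x' y y' → Rel (-s) x' x y' y
  unique : ∀ {G : Type} [TernaryGroup G] {s : ℤˣ} {x x₁ x₂ y y₁ y₂ : Λ → G},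
    Rel s x x₁ y y₁ → Rel s x x₂ y y₂ → x₁ = x₂ ∧ y₁ = y₂
  exists_loop : ∀ {G : Type} [TernaryGroup G] (s : ℤˣ) (x : Λ → G), ∃ x', Rel s x x' x' x
  loop_eq : ∀ {G : Type} [TernaryGroup G] {s : ℤˣ} {x x' y : Λ → G}, Rel s x x' x' y → x = y
  -- One orientation of the triangle is enough: the others arise from it by reversing strands.
  exists_triangle : ∀ {G : Type} [TernaryGroup G] {s : ℤˣ} {x₁ x₂ x₃ y₁ y₂ y₃ z₁ z₂ z₃ : Λ → G},
    Rel s x₁ x₂ y₁ y₂ → Rel s x₂ x₃ z₁ z₂ → Rel s y₂ y₃ z₂ z₃ →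
      ∃ x y z, Rel s x x₃ y y₃ ∧ Rel s x₁ x z z₃ ∧ Rel s y₁ y z₁ z

namespace KnotRule

open CrossingRule Code

variable {Λ : Type} (C : KnotRule Λ) {G : Type} [TernaryGroup G]

variable {C} in
-- Reversing the lower strand turns its outgoing color into an incoming one, so `unique` applies.
theorem unique' {s : ℤˣ} {x x₁ x₂ y y₁ y₂ : Λ → G}
    (h₁ : C.Rel s x x₁ y₁ y) (h₂ : C.Rel s x x₂ y₂ y) : x₁ = x₂ ∧ y₁ = y₂ := by
  obtain ⟨h, h'⟩ := C.unique (C.rev_lower h₁) (C.rev_lower h₂)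
  exact ⟨h, by rw [← C.rev_rev y₁, h', C.rev_rev]⟩

/-! #### Correspondences for the moves -/

/-- Covers the moves that only rename or identify edges: colorings are pulled back along `f`, and
the condition on incoming edges says that no color is lost or added. -/
theorem correspondence_of_comp (f : ℕ → ℕ) {D D' : Code}
    (hins : D'.ins.toFinset = D.ins.toFinset.image f)
    (h_right : ∀ {G : Type} [TernaryGroup G] {c : ℕ → Λ → G}, C.Coloring D c →
      ∃ c', C.Coloring D' c' ∧ c = c' ∘ f)
    (h_left : ∀ {G : Type} [TernaryGroup G] {c' : ℕ → Λ → G}, C.Coloring D' c' →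
      C.Coloring D (c' ∘ f)) : Nonempty (C.Correspondence D D') := by
  have mem_iff : ∀ k, k ∈ D'.ins ↔ ∃ l ∈ D.ins, f l = k := fun k => by
    rw [← Multiset.mem_toFinset, hins]; simp
  refine ⟨{ Rel := fun c c' => c = c' ∘ f, map := ?_, exists_right := h_right,
            exists_left := fun h => ⟨_, h_left h, rfl⟩, unique_right := ?_, unique_left := ?_ }⟩
  · rintro G H _ _ φ hφ c c' rfl
    rfl
  · rintro G _ _ _ c₁ c₂ - - - - rfl rfl h i hi
    obtain ⟨j, hj, rfl⟩ := (mem_iff i).1 hi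
    exact h j hj
  · rintro G _ _ _ c₁ c₂ - - - - rfl rfl h i hi
    exact h _ ((mem_iff _).2 ⟨i, hi, rfl⟩)

theorem correspondence_relabel {f : ℕ → ℕ} (hf : Function.Injective f) (L : Code) :
    Nonempty (C.Correspondence L (L.map (Vertex.relabel f))) := by
  refine C.correspondence_of_comp f ?_ ?_ (coloring_map_relabel f L).1
  · rw [ins_map_relabel, Multiset.toFinset_map]
  · intro G _ c hc
    -- Labels outside the range of `f` receive irrelevant colors; `invFun` makes a choice.
    have h : (c ∘ Function.invFun f) ∘ f = c := by
      rw [Function.comp_assoc, Function.invFun_comp hf, Function.comp_id]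
    exact ⟨c ∘ Function.invFun f, (coloring_map_relabel f L).2 (h.symm ▸ hc), h.symm⟩

theorem correspondence_remove_joint {i j : ℕ} (hij : i ≠ j) {L : Code}
    (hD : IsKnot (.joint (i, j) ::ₘ L)) :
    Nonempty (C.Correspondence (.joint (i, j) ::ₘ L)
      (L.map (Vertex.relabel (Function.update id j i)))) := by
  refine C.correspondence_of_comp (Function.update id j i) ?_ ?_ ?_
  -- Removing the joint removes its incoming edge `i`. After `j` is renamed to `i`, the vertex of
  -- `L` which `j` enters supplies `i` again.
  · have hj : j ∈ L.ins := by
      have : j ∈ Code.ins (.joint (i, j) ::ₘ L) := by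
        rw [← hD.outs_eq]; simp [Vertex.passes]
      simpa [Vertex.passes, Ne.symm hij] using this
    rw [ins_map_relabel, Multiset.toFinset_map]
    ext k
    simp only [Vertex.passes, ins_cons, Finset.mem_image, Multiset.mem_toFinset, Multiset.mem_add,
      Multiset.map_singleton, Multiset.mem_singleton]
    constructor
    · rintro ⟨l, hl, rfl⟩
      exact ⟨l, .inr hl, rfl⟩
    · rintro ⟨l, rfl | hl, rfl⟩
      · exact ⟨j, hj, by simp [hij]⟩
      · exact ⟨l, hl, rfl⟩
  · intro G _ c hc
    obtain ⟨hc, hcL⟩ := coloring_cons.1 hc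
    have h : c ∘ Function.update id j i = c := by
      funext k
      obtain rfl | hk := eq_or_ne k j
      · simpa [Compat] using hc
      · simp [hk]
    exact ⟨c, (coloring_map_relabel _ L).2 (h.symm ▸ hcL), h.symm⟩
  · intro G _ c hc
    exact coloring_cons.2 ⟨by simp [Compat, hij], (coloring_map_relabel _ L).1 hc⟩

theorem compat_reverse {c : ℕ → Λ → G} {v : Vertex} (h : C.Compat c v) :
    C.Compat (fun i => C.rev (c i)) v.reverse := by
  cases v with
  | joint p => exact congrArg C.rev h.symm
  | crossing s o u =>
    have := C.rev_lower (C.rev_upper h)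
    rwa [neg_neg] at this

theorem correspondence_reverse {L : Code} (hL : L.IsKnot) :
    Nonempty (C.Correspondence L (L.map Vertex.reverse)) := by
  have hins : Code.ins (L.map Vertex.reverse) = L.ins := by rw [ins_map_reverse, hL.outs_eq]
  have hcol : ∀ {G : Type} [TernaryGroup G] {c : ℕ → Λ → G} {D : Code}, C.Coloring D c →
      C.Coloring (D.map Vertex.reverse) (fun i => C.rev (c i)) := fun {G} _ c D hc v hv => by
    obtain ⟨w, hw, rfl⟩ := Multiset.mem_map.1 hv
    exact C.compat_reverse (hc w hw)
  have hrev : (L.map Vertex.reverse).map Vertex.reverse = L := by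
    rw [Multiset.map_map]
    refine (Multiset.map_congr rfl fun v _ => ?_).trans (Multiset.map_id L)
    cases v <;> rfl
  refine ⟨{ Rel := fun c c' => c' = fun i => C.rev (c i), map := ?_,
            exists_right := fun hc => ⟨_, hcol hc, rfl⟩, exists_left := ?_,
            unique_right := ?_, unique_left := ?_ }⟩
  · rintro G H _ _ φ hφ c _ rfl
    funext i
    exact C.comp_rev hφ (c i)
  · intro G _ c hc
    refine ⟨_, hrev ▸ hcol hc, ?_⟩
    simp only [C.rev_rev]
  · rintro G _ c₁ c₂ _ _ - - - - rfl rfl h i hi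
    exact congrArg C.rev (h i (hins ▸ hi))
  · rintro G _ c₁ c₂ _ _ - - - - rfl rfl h i hi
    rw [← C.rev_rev (c₁ i), ← C.rev_rev (c₂ i)]
    exact congrArg C.rev (h i (hins.symm ▸ hi))

/-- Two codes differ by a part `A`, `A'` whose colorings are determined by the colors of the edges
outside of a set `I` of inner edges. -/
theorem correspondence_local (I : Set ℕ) {A A' L : Code} (hD : (A + L).IsKnot)
    (hD' : (A' + L).IsKnot) (hin : ∀ i ∈ L.ins, i ∉ I) (hout : ∀ i ∈ L.outs, i ∉ I)
    (h_right : ∀ {G : Type} [TernaryGroup G] {c : ℕ → Λ → G}, C.Coloring (A + L) c →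
      ∃ c', C.Coloring A' c' ∧ ∀ i, i ∉ I → c i = c' i)
    (h_left : ∀ {G : Type} [TernaryGroup G] {c : ℕ → Λ → G}, C.Coloring (A' + L) c →
      ∃ c', C.Coloring A c' ∧ ∀ i, i ∉ I → c' i = c i)
    (hu_right : ∀ {G : Type} [TernaryGroup G] {c₁ c₂ : ℕ → Λ → G}, C.Coloring A' c₁ →
      C.Coloring A' c₂ → (∀ i ∈ A.ins + A.outs, i ∉ I → c₁ i = c₂ i) →
      ∀ i ∈ A'.ins, c₁ i = c₂ i)
    (hu_left : ∀ {G : Type} [TernaryGroup G] {c₁ c₂ : ℕ → Λ → G}, C.Coloring A c₁ →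
      C.Coloring A c₂ → (∀ i ∈ A'.ins + A'.outs, i ∉ I → c₁ i = c₂ i) →
      ∀ i ∈ A.ins, c₁ i = c₂ i) :
    Nonempty (C.Correspondence (A + L) (A' + L)) := by
  have hcol : ∀ {G : Type} [TernaryGroup G] {c c' : ℕ → Λ → G}, C.Coloring L c →
      (∀ i, i ∉ I → c i = c' i) → C.Coloring L c' := fun hc h v hv =>
    compat_congr (fun p hp => ⟨h _ (hin _ (fst_mem_ins hv hp)), h _ (hout _ (snd_mem_outs hv hp))⟩)
      (hc v hv)
  -- Stated for a general pair `B`, `B'` so that it serves both directions. An edge going out of `B`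
  -- is also an incoming edge of `B + L`, since the two collections agree in a knot diagram.
  have hunique : ∀ {G : Type} [TernaryGroup G] {B B' : Code} {c₁ c₂ c₁' c₂' : ℕ → Λ → G},
      (B + L).IsKnot →
      ((∀ i ∈ B.ins + B.outs, i ∉ I → c₁' i = c₂' i) → ∀ i ∈ B'.ins, c₁' i = c₂' i) →
      (∀ i, i ∉ I → c₁ i = c₁' i) → (∀ i, i ∉ I → c₂ i = c₂' i) →
      (∀ i ∈ (B + L).ins, c₁ i = c₂ i) → ∀ i ∈ (B' + L).ins, c₁' i = c₂' i := by
    intro G _ B B' c₁ c₂ c₁' c₂' hB hu h₁ h₂ h i hi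
    rw [ins_add, Multiset.mem_add] at hi
    obtain hi | hi := hi
    · refine hu (fun k hk hkI => ?_) i hi
      rw [← h₁ k hkI, ← h₂ k hkI]
      obtain hk | hk := Multiset.mem_add.1 hk
      · exact h k (by simp [hk])
      · exact h k (by rw [← hB.outs_eq]; simp [hk])
    · rw [← h₁ i (hin i hi), ← h₂ i (hin i hi)]
      exact h i (by simp [hi])
  refine ⟨{ Rel := fun c c' => ∀ i, i ∉ I → c i = c' i, map := ?_, exists_right := ?_,
            exists_left := ?_, unique_right := ?_, unique_left := ?_ }⟩
  · intro G H _ _ φ hφ c c' h i hi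
    simp only [h i hi]
  · intro G _ c hc
    obtain ⟨c', hc', h⟩ := h_right hc
    exact ⟨c', coloring_add.2 ⟨hc', hcol (coloring_add.1 hc).2 h⟩, h⟩
  · intro G _ c hc
    obtain ⟨c', hc', h⟩ := h_left hc
    exact ⟨c', coloring_add.2 ⟨hc', hcol (coloring_add.1 hc).2 fun i hi => (h i hi).symm⟩, h⟩
  · intro G _ c₁ c₂ c₁' c₂' k₁ k₂ k₁' k₂' h₁ h₂ h
    exact hunique hD (hu_right (coloring_add.1 k₁').1 (coloring_add.1 k₂').1) h₁ h₂ h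
  · intro G _ c₁ c₂ c₁' c₂' k₁ k₂ k₁' k₂' h₁ h₂ h
    exact hunique hD' (hu_left (coloring_add.1 k₁).1 (coloring_add.1 k₂).1)
      (fun i hi => (h₁ i hi).symm) (fun i hi => (h₂ i hi).symm) h

theorem coloring_singleton {v : Vertex} {c : ℕ → Λ → G} :
    C.Coloring {v} c ↔ C.Compat c v := by
  simp [Coloring]

/-- The inner edge is `j`. `loop_eq` closes the loop, `exists_loop` opens it, and `unique'` recovers
the color of `j` from those of `i` (incoming, upper) and `k` (outgoing, lower). -/
theorem correspondence_loop_over {s : ℤˣ} {i j k : ℕ} {L : Code}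
    (hD : IsKnot (.crossing s (i, j) (j, k) ::ₘ L)) (hD' : IsKnot (.joint (i, k) ::ₘ L)) :
    Nonempty (C.Correspondence (.crossing s (i, j) (j, k) ::ₘ L) (.joint (i, k) ::ₘ L)) := by
  have h₁ := hD.nodup
  have h₂ := hD.nodup_outs
  simp only [ins_cons, outs_cons, Vertex.passes, Multiset.insert_eq_cons, Multiset.map_cons,
    Multiset.map_singleton, Multiset.cons_add, Multiset.nodup_cons, Multiset.singleton_add,
    Multiset.mem_cons, not_or] at h₁ h₂
  obtain ⟨⟨hij, -⟩, hj, -⟩ := h₁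
  obtain ⟨⟨hjk, hj'⟩, -, -⟩ := h₂
  refine C.correspondence_local {j} (A := {.crossing s (i, j) (j, k)}) (A' := {.joint (i, k)})
    hD hD' ?_ ?_ ?_ ?_ ?_ ?_
  · rintro _ h rfl; exact hj h
  · rintro _ h rfl; exact hj' h
  · intro G _ c hc
    have hc := C.coloring_singleton.1 (coloring_add.1 hc).1
    exact ⟨c, C.coloring_singleton.2 (C.loop_eq hc), fun _ _ => rfl⟩
  · intro G _ c hc
    have hc : c i = c k := C.coloring_singleton.1 (coloring_add.1 hc).1
    obtain ⟨x, hx⟩ := C.exists_loop s (c i)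
    refine ⟨Function.update c j x, C.coloring_singleton.2 ?_, fun i hi => ?_⟩
    · simpa [Compat, hij, Ne.symm hjk, ← hc] using hx
    · exact Function.update_of_ne hi _ _
  · intro G _ c₁ c₂ hc₁ hc₂ h
    simpa [Vertex.passes] using h i (by simp [Vertex.passes]) hij
  · intro G _ c₁ c₂ hc₁ hc₂ h
    have hi := h i (by simp [Vertex.passes]) hij
    have hk := h k (by simp [Vertex.passes]) (Ne.symm hjk)
    have h₁ : C.Rel s (c₁ i) (c₁ j) (c₁ j) (c₁ k) := C.coloring_singleton.1 hc₁
    have h₂ : C.Rel s (c₂ i) (c₂ j) (c₂ j) (c₂ k) := C.coloring_singleton.1 hc₂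
    rw [hi, hk] at h₁
    simpa [Vertex.passes, hi] using (unique' h₁ h₂).1

/-- Reading the crossing backwards with `symm` exchanges the roles of `i` and `k` and reduces to the
conditions used for an upper loop. -/
theorem correspondence_loop_under {s : ℤˣ} {i j k : ℕ} {L : Code}
    (hD : IsKnot (.crossing s (j, k) (i, j) ::ₘ L)) (hD' : IsKnot (.joint (i, k) ::ₘ L)) :
    Nonempty (C.Correspondence (.crossing s (j, k) (i, j) ::ₘ L) (.joint (i, k) ::ₘ L)) := by
  have h₁ := hD.nodup
  have h₂ := hD.nodup_outs
  simp only [ins_cons, outs_cons, Vertex.passes, Multiset.insert_eq_cons, Multiset.map_cons,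
    Multiset.map_singleton, Multiset.cons_add, Multiset.nodup_cons, Multiset.singleton_add,
    Multiset.mem_cons, not_or] at h₁ h₂
  obtain ⟨⟨hij, hj⟩, -, -⟩ := h₁
  obtain ⟨⟨hjk, -⟩, hj', -⟩ := h₂
  refine C.correspondence_local {j} (A := {.crossing s (j, k) (i, j)}) (A' := {.joint (i, k)})
    hD hD' ?_ ?_ ?_ ?_ ?_ ?_
  · rintro _ h rfl; exact hj h
  · rintro _ h rfl; exact hj' h
  · intro G _ c hc
    have hc := C.coloring_singleton.1 (coloring_add.1 hc).1
    exact ⟨c, C.coloring_singleton.2 (C.loop_eq (C.symm hc)).symm, fun _ _ => rfl⟩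
  · intro G _ c hc
    have hc : c i = c k := C.coloring_singleton.1 (coloring_add.1 hc).1
    obtain ⟨x, hx⟩ := C.exists_loop (-s) (c i)
    have hx := C.symm hx
    rw [neg_neg] at hx
    refine ⟨Function.update c j x, C.coloring_singleton.2 ?_, fun i hi => ?_⟩
    · simpa [Compat, Ne.symm hij, hjk, ← hc] using hx
    · exact Function.update_of_ne hi _ _
  · intro G _ c₁ c₂ hc₁ hc₂ h
    simpa [Vertex.passes] using h i (by simp [Vertex.passes]) (Ne.symm hij)
  · intro G _ c₁ c₂ hc₁ hc₂ h
    have hi := h i (by simp [Vertex.passes]) (Ne.symm hij)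
    have hk := h k (by simp [Vertex.passes]) hjk
    have h₁ : C.Rel s (c₁ j) (c₁ k) (c₁ i) (c₁ j) := C.coloring_singleton.1 hc₁
    have h₂ : C.Rel s (c₂ j) (c₂ k) (c₂ i) (c₂ j) := C.coloring_singleton.1 hc₂
    rw [hi, hk] at h₁
    have := (unique' (C.symm h₁) (C.symm h₂)).1
    simpa [Vertex.passes, hi] using this

end KnotRule

/-! ### Edges of a bigon and of a triangle -/

namespace Code

theorem ins_bigon (s t : ℤˣ) (o u : ℕ × ℕ × ℕ) :
    (bigon s t o u).ins = {o.2.1, u.2.1, o.1, u.1} := by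
  obtain rfl | rfl := Int.units_eq_one_or t <;>
  · simp [bigon, segment, Vertex.passes, ← Multiset.singleton_add]
    abel

theorem outs_bigon (s t : ℤˣ) (o u : ℕ × ℕ × ℕ) :
    (bigon s t o u).outs = {o.2.1, u.2.1, o.2.2, u.2.2} := by
  obtain rfl | rfl := Int.units_eq_one_or t <;>
  · simp [bigon, segment, Vertex.passes, ← Multiset.singleton_add]
    abel

theorem ins_triangle (κ a b c : ℤˣ) (x y z : ℕ × ℕ × ℕ) :
    (triangle κ a b c x y z).ins = {x.2.1, y.2.1, z.2.1, x.1, y.1, z.1} := by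
  obtain rfl | rfl := Int.units_eq_one_or a <;> obtain rfl | rfl := Int.units_eq_one_or b <;>
  obtain rfl | rfl := Int.units_eq_one_or c <;>
  · simp [triangle, segment, Vertex.passes, ← Multiset.singleton_add]
    abel

theorem outs_triangle (κ a b c : ℤˣ) (x y z : ℕ × ℕ × ℕ) :
    (triangle κ a b c x y z).outs = {x.2.1, y.2.1, z.2.1, x.2.2, y.2.2, z.2.2} := by
  obtain rfl | rfl := Int.units_eq_one_or a <;> obtain rfl | rfl := Int.units_eq_one_or b <;>
  obtain rfl | rfl := Int.units_eq_one_or c <;>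
  · simp [triangle, segment, Vertex.passes, ← Multiset.singleton_add]
    abel

end Code

/-! ### The second and third Reidemeister moves -/

namespace KnotRule

open CrossingRule Code

variable {Λ : Type} (C : KnotRule Λ) {G : Type} [TernaryGroup G]

/-- The condition on the colors of the strands of a bigon. -/
def BigonRel (s t : ℤˣ) (x y : (Λ → G) × (Λ → G) × (Λ → G)) : Prop :=
  C.Rel s x.1 x.2.1 (strandPass t y).1 (strandPass t y).2 ∧
    C.Rel (-s) x.2.1 x.2.2 (strandPass (-t) y).1 (strandPass (-t) y).2

theorem coloring_bigon {s t : ℤˣ} {o u : ℕ × ℕ × ℕ} {c : ℕ → Λ → G} :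
    C.Coloring (bigon s t o u) c ↔
      C.BigonRel s t (o.map c (Prod.map c c)) (u.map c (Prod.map c c)) := by
  simp only [bigon, Multiset.insert_eq_cons, coloring_cons, coloring_singleton, BigonRel,
    ← map_segment]
  rfl

variable {C}

/-- The second crossing has the same data as the first one read backwards, so uniqueness forces the
outer colors of each strand to agree. -/
theorem BigonRel.eq {s t : ℤˣ} {x y : (Λ → G) × (Λ → G) × (Λ → G)} (h : C.BigonRel s t x y) :
    x.1 = x.2.2 ∧ y.1 = y.2.2 := by
  obtain ⟨h₁, h₂⟩ := h
  obtain rfl | rfl := Int.units_eq_one_or t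
  · exact C.unique (C.symm h₁) h₂
  · exact (unique' (C.symm h₁) h₂).imp id Eq.symm

theorem BigonRel.unique {s t : ℤˣ} {x y x' y' : (Λ → G) × (Λ → G) × (Λ → G)}
    (h : C.BigonRel s t x y) (h' : C.BigonRel s t x' y') (hx : x.1 = x'.1) (hy : y.1 = y'.1) :
    x.2.1 = x'.2.1 ∧ y.2.1 = y'.2.1 := by
  have e := h.eq
  have e' := h'.eq
  obtain ⟨h, -⟩ := h
  obtain ⟨h', -⟩ := h'
  obtain rfl | rfl := Int.units_eq_one_or t
  · simp only [strandPass, if_true, hx, hy] at h h'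
    exact C.unique h h'
  · have hy' : y.2.2 = y'.2.2 := by rw [← e.2, ← e'.2, hy]
    simp only [strandPass, hx, hy'] at h h'
    exact unique' h h'

theorem bigonRel_symm {s t : ℤˣ} {x x' y y' : Λ → G}
    (h : C.Rel s x x' (strandPass t (y, y', y)).1 (strandPass t (y, y', y)).2) :
    C.BigonRel s t (x, x', x) (y, y', y) := by
  refine ⟨h, ?_⟩
  obtain rfl | rfl := Int.units_eq_one_or t <;> exact C.symm h

variable (C) in
-- The hypothesis `hface` supplies inner colors for one crossing of the new bigon; `bigonRel_symm`
-- colors the other by reading the first backwards. Everything else is local.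
theorem correspondence_bigon {s t : ℤˣ} {o u : ℕ × ℕ × ℕ} {L : Code}
    (hD : (bigon s t o u + L).IsKnot)
    (hD' : IsKnot (.joint (o.1, o.2.2) ::ₘ .joint (u.1, u.2.2) ::ₘ L))
    (hface : ∀ {G : Type} [TernaryGroup G] {c : ℕ → Λ → G},
      C.Coloring (.joint (o.1, o.2.2) ::ₘ .joint (u.1, u.2.2) ::ₘ L) c → ∃ x y,
        C.Rel s (c o.1) x (strandPass t (c u.1, y, c u.1)).1 (strandPass t (c u.1, y, c u.1)).2) :
    Nonempty (C.Correspondence (bigon s t o u + L)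
      (.joint (o.1, o.2.2) ::ₘ .joint (u.1, u.2.2) ::ₘ L)) := by
  obtain ⟨o₁, o₂, o₃⟩ := o
  obtain ⟨u₁, u₂, u₃⟩ := u
  have h₁ := hD.nodup
  have h₂ := hD.nodup_outs
  simp only [ins_add, ins_bigon, outs_add, outs_bigon, Multiset.insert_eq_cons,
    Multiset.cons_add, Multiset.nodup_cons, Multiset.singleton_add,
    Multiset.mem_cons, not_or] at h₁ h₂
  obtain ⟨⟨hou, ho₁, hou₁, hoL⟩, ⟨huo₁, hu₁, huL⟩, -⟩ := h₁
  obtain ⟨⟨-, ho₃, hou₃, hoL'⟩, ⟨huo₃, hu₃, huL'⟩, -⟩ := h₂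
  have hA : (.joint (o₁, o₃) ::ₘ .joint (u₁, u₃) ::ₘ L) =
      ({.joint (o₁, o₃), .joint (u₁, u₃)} : Code) + L := by simp
  dsimp only at hD' hface ⊢
  rw [hA] at hD' ⊢
  have hsplit : ∀ {G : Type} [TernaryGroup G] {c : ℕ → Λ → G},
      C.Coloring ({.joint (o₁, o₃), .joint (u₁, u₃)} : Code) c ↔ c o₁ = c o₃ ∧ c u₁ = c u₃ := by
    simp [coloring_cons, coloring_singleton, Compat]
  refine C.correspondence_local {o₂, u₂} hD hD' ?_ ?_ ?_ ?_ ?_ ?_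
  · rintro _ h (rfl | rfl); exacts [hoL h, huL h]
  · rintro _ h (rfl | rfl); exacts [hoL' h, huL' h]
  · intro G _ c hc
    exact ⟨c, hsplit.2 (C.coloring_bigon.1 (coloring_add.1 hc).1).eq, fun _ _ => rfl⟩
  · intro G _ c hc
    obtain ⟨x, y, hxy⟩ := hface (hA ▸ hc)
    obtain ⟨ho, hu⟩ := hsplit.1 (coloring_add.1 hc).1
    refine ⟨Function.update (Function.update c o₂ x) u₂ y, C.coloring_bigon.2 ?_, fun i hi => ?_⟩
    · simpa [Prod.map, hou, Ne.symm ho₁, Ne.symm huo₁, Ne.symm hou₁, Ne.symm hu₁, Ne.symm ho₃,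
        Ne.symm huo₃, Ne.symm hou₃, Ne.symm hu₃, ← ho, ← hu] using bigonRel_symm hxy
    · simp only [Set.mem_insert_iff, Set.mem_singleton_iff, not_or] at hi
      simp [hi]
  · intro G _ c₁ c₂ hc₁ hc₂ h
    have ho := h o₁ (by simp [ins_bigon]) (by simp [Ne.symm ho₁, Ne.symm huo₁])
    have hu := h u₁ (by simp [ins_bigon]) (by simp [Ne.symm hu₁, Ne.symm hou₁])
    simp [Vertex.passes, ho, hu]
  · intro G _ c₁ c₂ hc₁ hc₂ h
    have ho := h o₁ (by simp [Vertex.passes]) (by simp [Ne.symm ho₁, Ne.symm huo₁])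
    have hu := h u₁ (by simp [Vertex.passes]) (by simp [Ne.symm hu₁, Ne.symm hou₁])
    have hi := (C.coloring_bigon.1 hc₁).unique (C.coloring_bigon.1 hc₂) ho hu
    simpa [ins_bigon, ho, hu] using hi

variable (C) in
/-- The condition on the colors of the strands of a triangle. -/
def TriangleRel (κ a b c : ℤˣ) (x y z : (Λ → G) × (Λ → G) × (Λ → G)) : Prop :=
  C.Rel (κ * a * b) (strandPass a x).1 (strandPass a x).2 (strandPass b y).1 (strandPass b y).2 ∧
  C.Rel (κ * a * c) (strandPass (-a) x).1 (strandPass (-a) x).2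
    (strandPass c z).1 (strandPass c z).2 ∧
  C.Rel (κ * b * c) (strandPass (-b) y).1 (strandPass (-b) y).2
    (strandPass (-c) z).1 (strandPass (-c) z).2

variable (C) in
theorem coloring_triangle {κ a b c : ℤˣ} {x y z : ℕ × ℕ × ℕ} {d : ℕ → Λ → G} :
    C.Coloring (triangle κ a b c x y z) d ↔
      C.TriangleRel κ a b c (x.map d (Prod.map d d)) (y.map d (Prod.map d d))
        (z.map d (Prod.map d d)) := by
  simp only [triangle, Multiset.insert_eq_cons, coloring_cons, coloring_singleton, TriangleRel,
    ← map_segment]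
  rfl

variable (C) in
/-- A strand with the reversed orientation. -/
def revStrand (x : (Λ → G) × (Λ → G) × (Λ → G)) : (Λ → G) × (Λ → G) × (Λ → G) :=
  (C.rev x.2.2, C.rev x.2.1, C.rev x.1)

theorem strandPass_revStrand (t : ℤˣ) (x : (Λ → G) × (Λ → G) × (Λ → G)) :
    strandPass (-t) (C.revStrand x) =
      (C.rev (strandPass t x).2, C.rev (strandPass t x).1) := by
  obtain rfl | rfl := Int.units_eq_one_or t <;> rfl

/-- Reversal changes the signs of both crossings on the strand and the order in which it meets them;
these changes are compatible with the same `κ`. -/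
theorem TriangleRel.rev_top {κ a b c : ℤˣ} {x y z : (Λ → G) × (Λ → G) × (Λ → G)}
    (h : C.TriangleRel κ a b c x y z) : C.TriangleRel κ (-a) b c (C.revStrand x) y z := by
  obtain ⟨h₁, h₂, h₃⟩ := h
  refine ⟨?_, ?_, h₃⟩
  · simpa only [strandPass_revStrand, mul_neg, neg_mul] using C.rev_upper h₁
  · simpa only [strandPass_revStrand, mul_neg, neg_mul] using C.rev_upper h₂

theorem TriangleRel.rev_middle {κ a b c : ℤˣ} {x y z : (Λ → G) × (Λ → G) × (Λ → G)}
    (h : C.TriangleRel κ a b c x y z) : C.TriangleRel κ a (-b) c x (C.revStrand y) z := by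
  obtain ⟨h₁, h₂, h₃⟩ := h
  refine ⟨?_, h₂, ?_⟩
  · simpa only [strandPass_revStrand, mul_neg, neg_mul] using C.rev_lower h₁
  · simpa only [strandPass_revStrand, mul_neg, neg_mul] using C.rev_upper h₃

theorem TriangleRel.rev_bottom {κ a b c : ℤˣ} {x y z : (Λ → G) × (Λ → G) × (Λ → G)}
    (h : C.TriangleRel κ a b c x y z) : C.TriangleRel κ a b (-c) x y (C.revStrand z) := by
  obtain ⟨h₁, h₂, h₃⟩ := h
  refine ⟨h₁, ?_, ?_⟩
  · simpa only [strandPass_revStrand, mul_neg, neg_mul] using C.rev_lower h₂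
  · simpa only [strandPass_revStrand, mul_neg, neg_mul] using C.rev_lower h₃

/-- Strands with parameter `-1` are reversed, the flip is made for `a = b = c = 1`, and the strands
are reversed back. -/
theorem TriangleRel.exists_flip {κ a b c : ℤˣ} {x y z : (Λ → G) × (Λ → G) × (Λ → G)}
    (h : C.TriangleRel κ a b c x y z) : ∃ x' y' z',
      C.TriangleRel κ (-a) (-b) (-c) (x.1, x', x.2.2) (y.1, y', y.2.2) (z.1, z', z.2.2) := by
  have h₀ : ∀ {x y z : (Λ → G) × (Λ → G) × (Λ → G)}, C.TriangleRel κ 1 1 1 x y z → ∃ x' y' z',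
      C.TriangleRel κ (-1) (-1) (-1) (x.1, x', x.2.2) (y.1, y', y.2.2) (z.1, z', z.2.2) := by
    intro x y z h
    simp only [TriangleRel, mul_one] at h
    obtain ⟨x', y', z', h⟩ := C.exists_triangle h.1 h.2.1 h.2.2
    exact ⟨x', y', z', by simpa [TriangleRel, strandPass] using h⟩
  have h₁ : ∀ {a : ℤˣ} {x y z : (Λ → G) × (Λ → G) × (Λ → G)}, C.TriangleRel κ a 1 1 x y z →
      ∃ x' y' z',
        C.TriangleRel κ (-a) (-1) (-1) (x.1, x', x.2.2) (y.1, y', y.2.2) (z.1, z', z.2.2) := by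
    intro a x y z h
    obtain rfl | rfl := Int.units_eq_one_or a
    · exact h₀ h
    · obtain ⟨x', y', z', h⟩ := h₀ h.rev_top
      exact ⟨C.rev x', y', z', by simpa [revStrand, C.rev_rev] using h.rev_top⟩
  have h₂ : ∀ {b : ℤˣ} {x y z : (Λ → G) × (Λ → G) × (Λ → G)}, C.TriangleRel κ a b 1 x y z →
      ∃ x' y' z',
        C.TriangleRel κ (-a) (-b) (-1) (x.1, x', x.2.2) (y.1, y', y.2.2) (z.1, z', z.2.2) := by
    intro b x y z h
    obtain rfl | rfl := Int.units_eq_one_or b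
    · exact h₁ h
    · obtain ⟨x', y', z', h⟩ := h₁ h.rev_middle
      exact ⟨x', C.rev y', z', by simpa [revStrand, C.rev_rev] using h.rev_middle⟩
  obtain rfl | rfl := Int.units_eq_one_or c
  · exact h₂ h
  · obtain ⟨x', y', z', h⟩ := h₂ h.rev_bottom
    exact ⟨x', y', C.rev z', by simpa [revStrand, C.rev_rev] using h.rev_bottom⟩

theorem rev_injective : Function.Injective (C.rev : (Λ → G) → Λ → G) :=
  Function.LeftInverse.injective C.rev_rev

theorem TriangleRel.unique {κ a b c : ℤˣ} {x₁ x₂ x₃ y₁ y₂ y₃ z₁ z₂ z₃ x y z : Λ → G}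
    (h : C.TriangleRel κ a b c (x₁, x₂, x₃) (y₁, y₂, y₃) (z₁, z₂, z₃))
    (h' : C.TriangleRel κ a b c (x₁, x, x₃) (y₁, y, y₃) (z₁, z, z₃)) :
    x₂ = x ∧ y₂ = y ∧ z₂ = z := by
  wlog ha : a = 1 generalizing a x₁ x₂ x₃ x
  · obtain rfl := (Int.units_eq_one_or a).resolve_left ha
    exact (this h.rev_top h'.rev_top (neg_neg 1)).imp (fun e => rev_injective e) id
  wlog hb : b = 1 generalizing b y₁ y₂ y₃ y
  · obtain rfl := (Int.units_eq_one_or b).resolve_left hb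
    exact (this h.rev_middle h'.rev_middle (neg_neg 1)).imp id
      (And.imp (fun e => rev_injective e) id)
  wlog hc : c = 1 generalizing c z₁ z₂ z₃ z
  · obtain rfl := (Int.units_eq_one_or c).resolve_left hc
    exact (this h.rev_bottom h'.rev_bottom (neg_neg 1)).imp id
      (And.imp id (fun e => rev_injective e))
  subst ha hb hc
  -- With all parameters `1`, the top and middle strands meet first, which determines `x₂` and `y₂`.
  -- Then `z₂` follows from the crossing of the top and bottom strands, read backwards.
  obtain ⟨h₁, h₂, -⟩ := h
  obtain ⟨h₁', h₂', -⟩ := h'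
  obtain ⟨rfl, hy⟩ := C.unique h₁ h₁'
  exact ⟨rfl, hy, (C.unique' (C.symm h₂) (C.symm h₂')).2⟩

variable (C) in
theorem correspondence_triangle {κ a b c : ℤˣ} {x y z : ℕ × ℕ × ℕ} {L : Code}
    (hD : (triangle κ a b c x y z + L).IsKnot)
    (hD' : (triangle κ (-a) (-b) (-c) x y z + L).IsKnot) :
    Nonempty (C.Correspondence (triangle κ a b c x y z + L)
      (triangle κ (-a) (-b) (-c) x y z + L)) := by
  obtain ⟨x₁, x₂, x₃⟩ := x
  obtain ⟨y₁, y₂, y₃⟩ := y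
  obtain ⟨z₁, z₂, z₃⟩ := z
  have h₁ := hD.nodup
  have h₂ := hD.nodup_outs
  simp only [ins_add, ins_triangle, outs_add, outs_triangle, Multiset.insert_eq_cons,
    Multiset.cons_add, Multiset.nodup_cons, Multiset.singleton_add,
    Multiset.mem_cons, not_or] at h₁ h₂
  obtain ⟨⟨hxy, hxz, hx₁, hxy₁, hxz₁, hxL⟩, ⟨hyz, hyx₁, hy₁, hyz₁, hyL⟩,
    ⟨hzx₁, hzy₁, hz₁, hzL⟩, -⟩ := h₁
  obtain ⟨⟨-, -, hx₃, hxy₃, hxz₃, hxL'⟩, ⟨-, hyx₃, hy₃, hyz₃, hyL'⟩,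
    ⟨hzx₃, hzy₃, hz₃, hzL'⟩, -⟩ := h₂
  have houter : x₁ ∉ ({x₂, y₂, z₂} : Set ℕ) ∧ x₃ ∉ ({x₂, y₂, z₂} : Set ℕ) ∧
      y₁ ∉ ({x₂, y₂, z₂} : Set ℕ) ∧ y₃ ∉ ({x₂, y₂, z₂} : Set ℕ) ∧
      z₁ ∉ ({x₂, y₂, z₂} : Set ℕ) ∧ z₃ ∉ ({x₂, y₂, z₂} : Set ℕ) := by
    simp only [Set.mem_insert_iff, Set.mem_singleton_iff]
    grind
  have hexists : ∀ {G : Type} [TernaryGroup G] {a b c : ℤˣ} {d : ℕ → Λ → G},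
      C.Coloring (triangle κ a b c (x₁, x₂, x₃) (y₁, y₂, y₃) (z₁, z₂, z₃)) d →
      ∃ d', C.Coloring (triangle κ (-a) (-b) (-c) (x₁, x₂, x₃) (y₁, y₂, y₃) (z₁, z₂, z₃)) d' ∧
        ∀ i, i ∉ ({x₂, y₂, z₂} : Set ℕ) → d' i = d i := by
    intro G _ a b c d hd
    obtain ⟨x', y', z', h⟩ := (C.coloring_triangle.1 hd).exists_flip
    let d' := Function.update (Function.update (Function.update d x₂ x') y₂ y') z₂ z'
    have hd' : ∀ i, i ∉ ({x₂, y₂, z₂} : Set ℕ) → d' i = d i := fun i hi => by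
      simp only [Set.mem_insert_iff, Set.mem_singleton_iff, not_or] at hi
      simp [d', hi]
    have hx : d' x₂ = x' := by simp [d', hxy, hxz]
    have hy : d' y₂ = y' := by simp [d', hyz]
    have hz : d' z₂ = z' := by simp [d']
    refine ⟨d', C.coloring_triangle.2 ?_, hd'⟩
    obtain ⟨k₁, k₂, k₃, k₄, k₅, k₆⟩ := houter
    simpa only [Prod.map, hx, hy, hz, hd' _ k₁, hd' _ k₂, hd' _ k₃, hd' _ k₄, hd' _ k₅, hd' _ k₆]
      using h
  have hunique : ∀ {G : Type} [TernaryGroup G] {a b c : ℤˣ} {d₁ d₂ : ℕ → Λ → G},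
      C.Coloring (triangle κ a b c (x₁, x₂, x₃) (y₁, y₂, y₃) (z₁, z₂, z₃)) d₁ →
      C.Coloring (triangle κ a b c (x₁, x₂, x₃) (y₁, y₂, y₃) (z₁, z₂, z₃)) d₂ →
      (∀ i ∈ (triangle κ (-a) (-b) (-c) (x₁, x₂, x₃) (y₁, y₂, y₃) (z₁, z₂, z₃)).ins +
        (triangle κ (-a) (-b) (-c) (x₁, x₂, x₃) (y₁, y₂, y₃) (z₁, z₂, z₃)).outs,
        i ∉ ({x₂, y₂, z₂} : Set ℕ) → d₁ i = d₂ i) →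
      ∀ i ∈ (triangle κ a b c (x₁, x₂, x₃) (y₁, y₂, y₃) (z₁, z₂, z₃)).ins, d₁ i = d₂ i := by
    intro G _ a b c d₁ d₂ hd₁ hd₂ h
    obtain ⟨k₁, k₂, k₃, k₄, k₅, k₆⟩ := houter
    have e₁ := h x₁ (by simp [ins_triangle]) k₁
    have e₂ := h x₃ (by simp [outs_triangle]) k₂
    have e₃ := h y₁ (by simp [ins_triangle]) k₃
    have e₄ := h y₃ (by simp [outs_triangle]) k₄
    have e₅ := h z₁ (by simp [ins_triangle]) k₅
    have e₆ := h z₃ (by simp [outs_triangle]) k₆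
    have hd₁ := C.coloring_triangle.1 hd₁
    have hd₂ := C.coloring_triangle.1 hd₂
    simp only [Prod.map, e₁, e₂, e₃, e₄, e₅, e₆] at hd₁ hd₂
    have hi := hd₁.unique hd₂
    simpa [ins_triangle, e₁, e₃, e₅] using hi
  refine C.correspondence_local {x₂, y₂, z₂} hD hD' ?_ ?_ ?_ ?_ ?_ ?_
  · rintro _ h (rfl | rfl | rfl); exacts [hxL h, hyL h, hzL h]
  · rintro _ h (rfl | rfl | rfl); exacts [hxL' h, hyL' h, hzL' h]
  · intro G _ d hd
    obtain ⟨d', hd', h⟩ := hexists (coloring_add.1 hd).1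
    exact ⟨d', hd', fun i hi => (h i hi).symm⟩
  · intro G _ d hd
    simpa only [neg_neg] using hexists (coloring_add.1 hd).1
  · intro G _ d₁ d₂ hd₁ hd₂ h
    exact hunique hd₁ hd₂ (by simpa only [neg_neg] using h)
  · intro G _ d₁ d₂ hd₁ hd₂ h
    exact hunique hd₁ hd₂ h

variable (C) in
/-- If a bigon can be colored whenever this is required by a Reidemeister move of the second type,
then the colorings of diagrams of the same knot correspond to each other. -/
theorem correspondence_of_move
    (hface : ∀ {s t : ℤˣ} {o u : ℕ × ℕ × ℕ} {L : Code}, (bigon s t o u + L).IsKnot →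
      IsKnot (.joint (o.1, o.2.2) ::ₘ .joint (u.1, u.2.2) ::ₘ L) →
      ∀ {G : Type} [TernaryGroup G] {c : ℕ → Λ → G},
      C.Coloring (.joint (o.1, o.2.2) ::ₘ .joint (u.1, u.2.2) ::ₘ L) c → ∃ x y,
        C.Rel s (c o.1) x (strandPass t (c u.1, y, c u.1)).1 (strandPass t (c u.1, y, c u.1)).2)
    {D D' : Code} (hD : D.IsKnot) (hD' : D'.IsKnot) (h : Move D D') :
    Nonempty (C.Correspondence D D') := by
  cases h with
  | relabel f hf => exact C.correspondence_relabel hf D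
  | remove_joint i j hij L => exact C.correspondence_remove_joint hij hD
  | reverse => exact C.correspondence_reverse hD
  | reidemeister₁_over s i j k L => exact C.correspondence_loop_over hD hD'
  | reidemeister₁_under s i j k L => exact C.correspondence_loop_under hD hD'
  | reidemeister₂ s t o u L => exact C.correspondence_bigon hD hD' (hface hD hD')
  | reidemeister₃ κ a b c x y z L => exact C.correspondence_triangle hD hD'

end KnotRule

/-! ### The Wirtinger rule -/

/-- The rule for the colors of arcs: the upper strand keeps its color `x`, and the colors of the
lower strand on the left and on the right satisfy `y' = [x̄ y x]`. -/
noncomputable def wirtingerRule : KnotRule Unit where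
  Rel s x x' y y' := x = x' ∧ (s = 1 → y' () = op (skew (x ())) (y ()) (x ())) ∧
    (s = -1 → y () = op (skew (x ())) (y' ()) (x ()))
  map := by
    rintro G H _ _ f hf s x x' y y' ⟨rfl, h₁, h₂⟩
    refine ⟨rfl, fun h => ?_, fun h => ?_⟩
    · simp [h₁ h, hf _ _ _, hf.map_skew]
    · simp [h₂ h, hf _ _ _, hf.map_skew]
  rev x i := skew (x i)
  rev_rev x := by simp
  comp_rev hf x := by funext i; exact hf.map_skew _
  rev_upper := by
    rintro G _ s x x' y y' ⟨rfl, h₁, h₂⟩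
    obtain rfl | rfl := Int.units_eq_one_or s
    · have h := h₁ rfl
      simp [h]
    · have h := h₂ rfl
      simp [h]
  rev_lower := by
    rintro G _ s x x' y y' ⟨rfl, h₁, h₂⟩
    obtain rfl | rfl := Int.units_eq_one_or s
    · have h := h₁ rfl
      simp [h]
    · have h := h₂ rfl
      simp [h]
  symm := by
    rintro G _ s x x' y y' ⟨rfl, h₁, h₂⟩
    obtain rfl | rfl := Int.units_eq_one_or s
    · have h := h₁ rfl
      simp [h]
    · have h := h₂ rfl
      simp [h]
  unique := by
    rintro G _ s x x₁ x₂ y y₁ y₂ ⟨rfl, h₁, h₂⟩ ⟨rfl, h₁', h₂'⟩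
    refine ⟨rfl, funext fun _ => ?_⟩
    obtain rfl | rfl := Int.units_eq_one_or s
    · exact (h₁ rfl).trans (h₁' rfl).symm
    · exact TernaryGroup.op_middle_injective ((h₂ rfl).symm.trans (h₂' rfl))
  exists_loop s x := ⟨x, by simp⟩
  loop_eq := by
    rintro G _ s x x' y ⟨rfl, h₁, h₂⟩
    funext
    obtain rfl | rfl := Int.units_eq_one_or s
    · simpa using (h₁ rfl).symm
    · have h := h₂ rfl
      refine TernaryGroup.op_middle_injective (a := skew (x ())) (c := x ()) ?_
      rw [← h]; simp
  exists_triangle := by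
    rintro G _ s x _ _ y₁ _ _ z₁ z₂ z₃ ⟨rfl, h₁, h₂⟩ ⟨rfl, h₃, h₄⟩ ⟨rfl, h₅, h₆⟩
    obtain rfl | rfl := Int.units_eq_one_or s
    · have h₁ := h₁ rfl
      have h₃ := h₃ rfl
      have h₅ := h₅ rfl
      -- The bottom strand now passes under the middle strand first. That the outer colors still fit
      -- is the compatibility of conjugation by `x` with the operation.
      refine ⟨x, y₁, fun _ => op (skew (y₁ ())) (z₁ ()) (y₁ ()), ?_⟩
      simp [h₁, h₃, h₅]
    · have h₁ := h₂ rfl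
      have h₃ := h₄ rfl
      have h₅ := h₆ rfl
      -- For negative crossings the rule gives the incoming color from the outgoing one, so the
      -- inner color is computed back from `z₃`.
      refine ⟨x, y₁, fun _ => op (skew (x ())) (z₃ ()) (x ()), ?_⟩
      simp [h₁, h₃, h₅]

/-- An assignment of values to the edges which is constant on arcs. -/
theorem Code.exists_arc_lift {D : Code} {X : Type*} (c : ℕ → X)
    (h : ∀ i j, (Vertex.joint (i, j) ∈ D ∨ ∃ s u, Vertex.crossing s (i, j) u ∈ D) → c i = c j) :
    ∃ φ : D.Arc → X, ∀ i : D.Edge, φ (D.arc i) = c i.1 :=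
  ⟨Quot.lift (fun i => c i.1) fun i j hij => h i.1 j.1 hij, fun _ => rfl⟩

open CrossingRule Code

theorem KnotDiagram.represents_wirtinger (D : KnotDiagram) :
    wirtingerRule.Represents D.code D.wirtingerTernaryGroup := by
  let c : ℕ → Unit → D.wirtingerTernaryGroup := fun i _ =>
    Presented.mk (.gen (if h : i ∈ D.code.ins then D.code.arc ⟨i, h⟩ else Classical.arbitrary _))
  have hc : ∀ i : D.code.Edge, c i.1 () = Presented.mk (.gen (D.code.arc i)) := fun i =>
    congrArg (fun a => Presented.mk (.gen a)) (dif_pos i.2)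
  refine ⟨c, ?_, ?_, ?_⟩
  · intro v hv
    have hin : ∀ p ∈ v.passes, p.1 ∈ D.code.ins := fun p hp => fst_mem_ins hv hp
    have hout : ∀ p ∈ v.passes, p.2 ∈ D.code.ins := fun p hp => D.isKnot.snd_mem_ins hv hp
    cases v with
    | joint p =>
      simp only [Vertex.passes, Multiset.mem_singleton, forall_eq] at hin hout
      funext
      refine (hc ⟨_, hin⟩).trans (Eq.trans ?_ (hc ⟨_, hout⟩).symm)
      exact congrArg (fun a => Presented.mk (.gen a)) (Quot.sound (.inl hv))
    | crossing s o u =>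
      simp only [Vertex.passes, Multiset.insert_eq_cons, Multiset.mem_cons, Multiset.mem_singleton,
        forall_eq_or_imp, forall_eq] at hin hout
      have h₁ := hc ⟨_, hin.1⟩
      have h₂ := hc ⟨_, hout.1⟩
      have h₃ := hc ⟨_, hin.2⟩
      have h₄ := hc ⟨_, hout.2⟩
      refine ⟨funext fun _ => ?_, ?_, ?_⟩
      · refine h₁.trans (Eq.trans ?_ h₂.symm)
        exact congrArg (fun a => Presented.mk (.gen a)) (Quot.sound (.inr ⟨s, u, hv⟩))
      · rintro rfl
        rw [h₁, h₃, h₄, Presented.skew_mk]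
        exact Quotient.sound (.of ⟨⟨_, hout.2⟩, ⟨_, hin.1⟩, ⟨_, hout.1⟩, ⟨_, hin.2⟩, .inl hv, rfl⟩)
      · rintro rfl
        rw [h₁, h₃, h₄, Presented.skew_mk]
        exact Quotient.sound (.of ⟨⟨_, hin.2⟩, ⟨_, hin.1⟩, ⟨_, hout.1⟩, ⟨_, hout.2⟩, .inr hv, rfl⟩)
  · intro G _ d hd
    obtain ⟨φ, hφ⟩ := D.code.exists_arc_lift (fun i => d i ()) (by
      rintro i j (h | ⟨s, u, h⟩)
      · exact congrFun (hd _ h) ()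
      · exact congrFun (hd _ h).1 ())
    obtain ⟨h, hh, hφh⟩ := Presented.exists_lift (R := wirtingerRelations D.code) φ (by
      rintro _ ⟨i, j, j', k, h, rfl⟩
      simp only [TWord.eval, hφ]
      obtain h | h := h
      · exact (hd _ h).2.1 rfl
      · exact (hd _ h).2.2 rfl)
    refine ⟨h, hh, fun i hi => funext fun _ => ?_⟩
    exact (congrArg h (hc ⟨i, hi⟩)).trans ((hφh _).trans (hφ _))
  · intro G _ f g hf hg h
    refine Presented.hom_ext hf hg fun s => ?_
    induction s using Quot.ind with | _ i
    have := congrFun (h i.1 i.2) ()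
    simp only [Function.comp, hc] at this
    exact this

/-! ### The Dehn rule -/

theorem units_eq_or_eq_neg (ε s : ℤˣ) : ε = s ∨ ε = -s := by
  decide +revert

/-- The rule for the colors of the two sides of the edges: at a crossing, sides of the same region
have the same color, and the colors satisfy the relation `d = [a b̄ c]`. -/
noncomputable def dehnRule : KnotRule ℤˣ where
  Rel s x x' y y' := (x (-s) = y s ∧ x s = y' s ∧ x' (-s) = y (-s) ∧ x' s = y' (-s)) ∧
    x 1 = op (x' 1) (skew (x' (-1))) (x (-1))
  map := by
    rintro G H _ _ f hf s x x' y y' ⟨⟨h₁, h₂, h₃, h₄⟩, h⟩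
    refine ⟨?_, ?_⟩
    · simp [h₁, h₂, h₃, h₄]
    · simp [h, hf _ _ _, hf.map_skew]
  rev x i := x (-i)
  rev_rev x := by simp
  comp_rev hf x := rfl
  rev_upper := by
    rintro G _ s x x' y y' ⟨⟨h₁, h₂, h₃, h₄⟩, h⟩
    simp only [neg_neg]
    refine ⟨⟨h₃, h₄, h₁, h₂⟩, ?_⟩
    simp [h]
  rev_lower := by
    rintro G _ s x x' y y' ⟨⟨h₁, h₂, h₃, h₄⟩, h⟩
    simp only [neg_neg]
    exact ⟨⟨h₂, h₁, h₄, h₃⟩, h⟩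
  symm := by
    rintro G _ s x x' y y' ⟨⟨h₁, h₂, h₃, h₄⟩, h⟩
    simp only [neg_neg]
    refine ⟨⟨h₄, h₃, h₂, h₁⟩, ?_⟩
    simp [h]
  unique := by
    rintro G _ s x x₁ x₂ y y₁ y₂ ⟨⟨h₁, h₂, h₃, h₄⟩, h⟩ ⟨⟨h₁', h₂', h₃', h₄'⟩, h'⟩
    have e : x₁ (-s) = x₂ (-s) := h₃.trans h₃'.symm
    -- The corners already fix the color on the side `-s`. The remaining color is the only unknown
    -- in the crossing relation: its first entry for `s = 1`, its skewed middle entry for `s = -1`.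
    have e' : x₁ s = x₂ s := by
      obtain rfl | rfl := Int.units_eq_one_or s
      · rw [h, e] at h'
        exact TernaryGroup.op_right_injective h'
      · rw [neg_neg] at e
        rw [h, e] at h'
        rw [← TernaryGroup.skew_skew (x₁ (-1)), TernaryGroup.op_middle_injective h',
          TernaryGroup.skew_skew]
    refine ⟨funext fun ε => ?_, funext fun ε => ?_⟩
    · obtain rfl | rfl := units_eq_or_eq_neg ε s
      · exact e'
      · exact e
    · obtain rfl | rfl := units_eq_or_eq_neg ε s
      · exact h₂.symm.trans h₂'
      · rw [← h₄, ← h₄', e']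
  exists_loop s x := by
    -- The side `s` of the loop edge shares a corner with the region outside; the other side is the
    -- interior of the loop, whose color is solved from the crossing relation.
    refine ⟨fun ε => if ε = s then x (-s) else op (x (-s)) (skew (x s)) (x (-s)), ?_⟩
    obtain rfl | rfl := Int.units_eq_one_or s <;> simp
  loop_eq := by
    rintro G _ s x x' y ⟨⟨h₁, h₂, h₃, h₄⟩, h⟩
    funext ε
    obtain rfl | rfl := units_eq_or_eq_neg ε s
    · exact h₂
    · exact h₁.trans h₄
  exists_triangle := by
    rintro G _ s x₁ x₂ x₃ y₁ y₂ y₃ z₁ z₂ z₃ ⟨⟨a₁, a₂, a₃, a₄⟩, a⟩ ⟨⟨b₁, b₂, b₃, b₄⟩, b⟩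
      ⟨⟨c₁, c₂, c₃, c₄⟩, c⟩
    -- The common value `[x₁(-s), skew of x₁(s), y₃(s)]` is the color of the new triangle, solved
    -- from the crossing of the top and bottom strands. The other sides of the inner edges lie on
    -- outer regions.
    refine ⟨fun ε => if ε = s then y₃ s else op (x₁ (-s)) (skew (x₁ s)) (y₃ s),
      fun ε => if ε = -s then x₃ (-s) else op (x₁ (-s)) (skew (x₁ s)) (y₃ s),
      fun ε => if ε = s then x₁ (-s) else op (x₁ (-s)) (skew (x₁ s)) (y₃ s), ?_⟩
    obtain rfl | rfl := Int.units_eq_one_or s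
    -- `e₁` and `e₂` relate outer colors only: the color of the old triangle has been eliminated.
    -- They yield the two crossing relations not used to define the new one.
    · have e₁ : x₁ 1 = op (x₃ 1) (skew (x₃ (-1))) (x₁ (-1)) := by rw [a, b]; simp
      have e₂ : x₁ 1 = op (y₃ 1) (skew (x₃ (-1))) (y₁ (-1)) := by
        rw [a₂, c, ← a₄, b, c₃, ← b₄, a₃]; simp
      refine ⟨⟨?_, ?_⟩, ⟨?_, ?_⟩, ?_, ?_⟩
      · clear a b c e₁ e₂; simp_all
      · simp [e₁]
      · clear a b c e₁ e₂; simp_all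
      · simp
      · clear a b c e₁ e₂; simp_all
      · simp [e₂, ← a₁]
    · have e₁ : x₁ 1 = op (x₃ 1) (skew (x₃ (-1))) (x₁ (-1)) := by rw [a, b]; simp
      simp only [neg_neg] at *
      have e₂ : y₁ 1 = op (x₃ 1) (skew (y₃ (-1))) (x₁ (-1)) := by
        rw [← a₃, b, a₄, c, c₃, ← b₄, a₂]; simp
      refine ⟨⟨?_, ?_⟩, ⟨?_, ?_⟩, ?_, ?_⟩
      · clear a b c e₁ e₂; simp_all
      · simp [e₁]
      · clear a b c e₁ e₂; simp_all
      · simp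
      · clear a b c e₁ e₂; simp_all
      · simp [e₂, ← a₁]

/-! ### Regions -/

/-- The condition that four pairs of sides at a crossing have a common corner. -/
theorem Vertex.adj_crossing {X : Type*} {s : ℤˣ} {o u : ℕ × ℕ} {c : ℕ → ℤˣ → X}
    (h : ∀ x y, (Vertex.crossing s o u).Adj x y → c x.1 x.2 = c y.1 y.2) :
    c o.1 (-s) = c u.1 s ∧ c o.1 s = c u.2 s ∧ c o.2 (-s) = c u.1 (-s) ∧ c o.2 s = c u.2 (-s) :=
  ⟨h _ _ (.in_in s o u), h _ _ (.in_out s o u), h _ _ (.out_in s o u), h _ _ (.out_out s o u)⟩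

theorem dehnRule_adj {G : Type} [TernaryGroup G] {c : ℕ → ℤˣ → G} {v : Vertex}
    (h : dehnRule.Compat c v) {x y : ℕ × ℤˣ} (hxy : v.Adj x y) : c x.1 x.2 = c y.1 y.2 := by
  cases hxy with
  | joint p ε => exact congrFun h ε
  | in_in s o u => exact h.1.1
  | in_out s o u => exact h.1.2.1
  | out_in s o u => exact h.1.2.2.1
  | out_out s o u => exact h.1.2.2.2

namespace Code

/-- An assignment of values to the sides of edges which is constant on regions. -/
theorem exists_region_lift {D : Code} {X : Type*} (c : ℕ → ℤˣ → X)
    (h : ∀ v ∈ D, ∀ x y, v.Adj x y → c x.1 x.2 = c y.1 y.2) :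
    ∃ φ : D.Region → X, ∀ (i : D.Edge) (ε : ℤˣ), φ (D.region i ε) = c i.1 ε :=
  ⟨Quot.lift (fun x => c x.1.1 x.2) fun _ _ ⟨v, hv, hxy⟩ => h v hv _ _ hxy, fun _ _ => rfl⟩

namespace IsKnot

variable {D : Code} (hD : D.IsKnot)

/-- The region at a side of an edge. -/
noncomputable def regionAt (i : ℕ) (ε : ℤˣ) : D.Region :=
  if h : i ∈ D.ins then D.region ⟨i, h⟩ ε
  else D.region ⟨_, (exists_mem_ins hD.ne_zero).choose_spec⟩ ε

theorem regionAt_coe (i : D.Edge) (ε : ℤˣ) : hD.regionAt i.1 ε = D.region i ε := dif_pos i.2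

theorem exists_regionAt_eq (r : D.Region) : ∃ i ∈ D.ins, ∃ ε, hD.regionAt i ε = r := by
  induction r using Quot.ind with | _ x
  exact ⟨x.1.1, x.1.2, x.2, hD.regionAt_coe x.1 x.2⟩

theorem mem_ins_of_adj (hD : D.IsKnot) {v : Vertex} (hv : v ∈ D) {x y : ℕ × ℤˣ} (h : v.Adj x y) :
    x.1 ∈ D.ins ∧ y.1 ∈ D.ins := by
  cases h <;> constructor <;>
  first
    | exact fst_mem_ins hv (by simp [Vertex.passes])
    | exact hD.snd_mem_ins hv (by simp [Vertex.passes])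

theorem regionAt_eq {v : Vertex} (hv : v ∈ D) (x y : ℕ × ℤˣ) (h : v.Adj x y) :
    hD.regionAt x.1 x.2 = hD.regionAt y.1 y.2 := by
  obtain ⟨hx, hy⟩ := hD.mem_ins_of_adj hv h
  rw [hD.regionAt_coe ⟨_, hx⟩, hD.regionAt_coe ⟨_, hy⟩]
  exact Quot.sound ⟨v, hv, h⟩

end IsKnot

@[simp] theorem numCrossings_joint_cons (p : ℕ × ℕ) (L : Code) :
    numCrossings (.joint p ::ₘ L) = numCrossings L :=
  Multiset.countP_cons_of_neg _ Bool.false_ne_true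

@[simp] theorem numCrossings_crossing_cons (s : ℤˣ) (o u : ℕ × ℕ) (L : Code) :
    numCrossings (.crossing s o u ::ₘ L) = numCrossings L + 1 :=
  Multiset.countP_cons_of_pos _ rfl

/-- The sides of the edges of a bigon which belong to the same region. -/
theorem bigon_sides {X : Type*} {s t : ℤˣ} {o u : ℕ × ℕ × ℕ} {c : ℕ → ℤˣ → X}
    (h : ∀ v ∈ bigon s t o u, ∀ x y, v.Adj x y → c x.1 x.2 = c y.1 y.2) :
    c o.1 (s * t) = c o.2.2 (s * t) ∧ c u.1 (-s) = c u.2.2 (-s) ∧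
    (∀ i, i = u.1 ∨ i = u.2.2 → c i s = c o.1 (-(s * t)) ∨ c i s = c o.2.2 (-(s * t))) ∧
    c o.2.1 (-(s * t)) = c u.1 (-s) ∧ c u.2.1 s = c o.1 (s * t) ∧
    c u.2.1 (-s) = c o.2.1 (s * t) := by
  have h₁ := Vertex.adj_crossing (h (.crossing s (segment 1 o) (segment t u)) (by simp [bigon]))
  have h₂ := Vertex.adj_crossing
    (h (.crossing (-s) (segment (-1) o) (segment (-t) u)) (by simp [bigon]))
  obtain rfl | rfl := Int.units_eq_one_or t
  · simp [segment] at h₁ h₂ ⊢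
    grind
  · simp [segment] at h₁ h₂ ⊢
    grind

/-- Let `n` be the number of crossings of `L`, so the diagrams have `n + 4` and `n + 2` regions.
With the bigon, the space between the strands is split into the regions `N` and `S` at its two ends,
and `B` is the bigon itself. If the facing sides belonged to distinct regions `P` and `Q` after
separation, both would map to the merged `N` and `S`, leaving at most `n + 1` images. Restoring `S`
and `B` gives at most `n + 3` regions, too few. -/
theorem region_eq_of_bigon {s t : ℤˣ} {o u : ℕ × ℕ × ℕ} {L : Code}
    (hD : (bigon s t o u + L).IsKnot)
    (hD' : IsKnot (.joint (o.1, o.2.2) ::ₘ .joint (u.1, u.2.2) ::ₘ L)) :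
    hD'.regionAt o.1 (-(s * t)) = hD'.regionAt u.1 s := by
  classical
  by_contra hne
  set P := hD'.regionAt o.1 (-(s * t))
  set Q := hD'.regionAt u.1 s
  obtain ⟨e₁, e₂, e₃, e₄, e₅, e₆⟩ := bigon_sides (c := hD.regionAt)
    fun v (hv : v ∈ bigon s t o u) => hD.regionAt_eq (by simp [hv])
  set N := hD.regionAt o.1 (-(s * t))
  set S := hD.regionAt o.2.2 (-(s * t))
  set B := hD.regionAt o.2.1 (s * t)
  -- Merging `S` into `N` makes the old regions constant along the new joints, so that they define a
  -- map `g` on the regions of the separated diagram.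
  let π : ℕ → ℤˣ → Region (bigon s t o u + L) := fun i ε =>
    if hD.regionAt i ε = S then N else hD.regionAt i ε
  have hπ : ∀ i ε, hD.regionAt i ε = S ∨ hD.regionAt i ε = π i ε := fun i ε =>
    or_iff_not_imp_left.2 fun h => (if_neg h).symm
  have hN : ∀ i ε, hD.regionAt i ε = N ∨ hD.regionAt i ε = S → π i ε = N := by
    rintro i ε (h | h) <;> simp [π, h]
  obtain ⟨g, hg⟩ := exists_region_lift
    (D := .joint (o.1, o.2.2) ::ₘ .joint (u.1, u.2.2) ::ₘ L) π (by
      intro v hv x y hxy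
      simp only [Multiset.mem_cons] at hv
      obtain rfl | rfl | hv := hv
      · cases hxy with | joint _ ε
        obtain rfl | rfl := units_eq_or_eq_neg ε (s * t)
        · simp only [π, e₁]
        · exact (hN _ _ (.inl rfl)).trans (hN _ _ (.inr rfl)).symm
      · cases hxy with | joint _ ε
        obtain rfl | rfl := units_eq_or_eq_neg ε s
        · exact (hN _ _ (e₃ _ (.inl rfl))).trans (hN _ _ (e₃ _ (.inr rfl))).symm
        · simp only [π, e₂]
      · simp only [π, hD.regionAt_eq (Multiset.mem_add.2 (.inr hv)) x y hxy])
  have hg' : ∀ i ∈ Code.ins (.joint (o.1, o.2.2) ::ₘ .joint (u.1, u.2.2) ::ₘ L), ∀ ε,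
      g (hD'.regionAt i ε) = π i ε := fun i hi ε =>
    (congrArg g (hD'.regionAt_coe ⟨i, hi⟩ ε)).trans (hg _ _)
  have ho : o.1 ∈ Code.ins (.joint (o.1, o.2.2) ::ₘ .joint (u.1, u.2.2) ::ₘ L) := by
    simp [Vertex.passes]
  have hu : u.1 ∈ Code.ins (.joint (o.1, o.2.2) ::ₘ .joint (u.1, u.2.2) ::ₘ L) := by
    simp [Vertex.passes]
  have hPQ : g P = g Q :=
    ((hg' _ ho _).trans (hN _ _ (.inl rfl))).trans
      ((hg' _ hu _).trans (hN _ _ (e₃ _ (.inl rfl)))).symm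
  have hmem : ∀ i ∈ Code.ins (.joint (o.1, o.2.2) ::ₘ .joint (u.1, u.2.2) ::ₘ L), ∀ ε,
      hD.regionAt i ε ∈ insert B (insert S (g '' {Q}ᶜ)) := by
    intro i hi ε
    obtain h | h := hπ i ε
    · simp [h]
    · refine .inr (.inr ?_)
      rw [h, ← hg' i hi ε]
      by_cases hq : hD'.regionAt i ε = Q
      -- `Q` may be dropped from the source of `g`, since `P` has the same image.
      · exact ⟨P, hne, hPQ.trans (congrArg g hq.symm)⟩
      · exact ⟨_, hq, rfl⟩
  have hcover : Set.univ ⊆ insert B (insert S (g '' {Q}ᶜ)) := by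
    rintro r -
    obtain ⟨i, hi, ε, rfl⟩ := hD.exists_regionAt_eq r
    rw [ins_add, ins_bigon] at hi
    simp only [Multiset.insert_eq_cons, Multiset.mem_add, Multiset.mem_cons,
      Multiset.mem_singleton] at hi
    obtain (rfl | rfl | rfl | rfl) | hi := hi
    · obtain rfl | rfl := units_eq_or_eq_neg ε (s * t)
      · exact .inl rfl
      · exact e₄ ▸ hmem _ hu _
    · obtain rfl | rfl := units_eq_or_eq_neg ε s
      · exact e₅ ▸ hmem _ ho _
      · exact .inl e₆
    · exact hmem _ ho _
    · exact hmem _ hu _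
    · exact hmem _ (by simp [hi]) _
  have hcard := hD.spherical
  have hcard' := hD'.spherical
  have : Finite (Region (.joint (o.1, o.2.2) ::ₘ .joint (u.1, u.2.2) ::ₘ L)) :=
    Nat.finite_of_card_ne_zero (by rw [hcard']; omega)
  have h₁ := Set.ncard_le_ncard hcover ((Set.toFinite _))
  have h₂ := Set.ncard_insert_le B (insert S (g '' {Q}ᶜ))
  have h₃ := Set.ncard_insert_le S (g '' {Q}ᶜ)
  have h₄ := Set.ncard_image_le (f := g) (Set.toFinite {Q}ᶜ)
  have h₅ := Set.ncard_add_ncard_compl {Q}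
  rw [Set.ncard_singleton] at h₅
  rw [Set.ncard_univ] at h₁
  have k₁ : numCrossings (bigon s t o u + L) = numCrossings L + 2 := by
    simp [bigon]
  have k₂ : numCrossings (.joint (o.1, o.2.2) ::ₘ .joint (u.1, u.2.2) ::ₘ L) =
      numCrossings L := by
    simp
  omega

end Code

/-! ### The two groups represent colorings -/

theorem KnotDiagram.represents_dehn (D : KnotDiagram) :
    dehnRule.Represents D.code D.dehnTernaryGroup := by
  let c : ℕ → ℤˣ → D.dehnTernaryGroup := fun i ε => Presented.mk (.gen (D.isKnot.regionAt i ε))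
  have hc : ∀ (i : D.code.Edge) ε, c i.1 ε = Presented.mk (.gen (D.code.region i ε)) :=
    fun i ε => congrArg (fun a => Presented.mk (.gen a)) (D.isKnot.regionAt_coe i ε)
  have hadj : ∀ v ∈ D.code, ∀ x y, v.Adj x y → c x.1 x.2 = c y.1 y.2 := fun v hv x y h =>
    congrArg (fun a => Presented.mk (.gen a)) (D.isKnot.regionAt_eq hv x y h)
  refine ⟨c, ?_, ?_, ?_⟩
  · intro v hv
    cases v with
    | joint p => exact funext fun ε => hadj _ hv _ _ (.joint p ε)
    | crossing s o u =>
      refine ⟨Vertex.adj_crossing (hadj _ hv), ?_⟩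
      have hin : o.1 ∈ D.code.ins := fst_mem_ins hv (by simp [Vertex.passes])
      have hout : o.2 ∈ D.code.ins := D.isKnot.snd_mem_ins hv (by simp [Vertex.passes])
      rw [hc ⟨_, hin⟩, hc ⟨_, hin⟩, hc ⟨_, hout⟩, hc ⟨_, hout⟩, Presented.skew_mk]
      exact Quotient.sound (.of ⟨s, u, ⟨_, hin⟩, ⟨_, hout⟩, hv, rfl⟩)
  · intro G _ d hd
    obtain ⟨φ, hφ⟩ := exists_region_lift d fun v hv x y h => dehnRule_adj (hd v hv) h
    obtain ⟨h, hh, hφh⟩ := Presented.exists_lift (R := dehnRelations D.code) φ (by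
      rintro _ ⟨s, u, i, j, h, rfl⟩
      simp only [TWord.eval, hφ]
      exact (hd _ h).2)
    refine ⟨h, hh, fun i hi => funext fun ε => ?_⟩
    exact (congrArg h (hc ⟨i, hi⟩ ε)).trans ((hφh _).trans (hφ _ _))
  · intro G _ f g hf hg h
    refine Presented.hom_ext hf hg fun r => ?_
    obtain ⟨i, hi, ε, rfl⟩ := D.isKnot.exists_regionAt_eq r
    exact congrFun (h i hi) ε

/-! ### From moves to isomorphisms -/

theorem dehnRule_exists_of_eq {G : Type} [TernaryGroup G] {s : ℤˣ} {x y : ℤˣ → G}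
    (h : x (-s) = y s) : ∃ x' y', dehnRule.Rel s x x' y y' := by
  -- The `op` value is the color of the bigon, solved from the crossing relation; the other inner
  -- sides continue outer regions.
  refine ⟨fun ε => if ε = s then op (x s) (skew (x (-s))) (y (-s)) else y (-s),
    fun ε => if ε = s then x s else op (x s) (skew (x (-s))) (y (-s)), ?_, ?_⟩
  · obtain rfl | rfl := Int.units_eq_one_or s <;> simpa using h
  · obtain rfl | rfl := Int.units_eq_one_or s <;> simp

theorem nonempty_iso_of_sameKnot {Λ : Type} (C : KnotRule Λ) {P : KnotDiagram → Type}
    [∀ D, TernaryGroup (P D)] (hP : ∀ D, C.Represents D.code (P D))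
    (hface : ∀ {s t : ℤˣ} {o u : ℕ × ℕ × ℕ} {L : Code}, (bigon s t o u + L).IsKnot →
      IsKnot (.joint (o.1, o.2.2) ::ₘ .joint (u.1, u.2.2) ::ₘ L) →
      ∀ {G : Type} [TernaryGroup G] {c : ℕ → Λ → G},
      C.Coloring (.joint (o.1, o.2.2) ::ₘ .joint (u.1, u.2.2) ::ₘ L) c → ∃ x y,
        C.Rel s (c o.1) x (strandPass t (c u.1, y, c u.1)).1 (strandPass t (c u.1, y, c u.1)).2)
    {D D' : KnotDiagram} (h : SameKnot D D') : Nonempty (TernaryIso (P D) (P D')) := by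
  induction h with
  | rel D D' h =>
    obtain ⟨T⟩ := C.correspondence_of_move hface D.isKnot D'.isKnot h
    exact T.nonempty_iso (hP D) (hP D')
  | refl D => exact ⟨⟨Equiv.refl _, fun _ _ _ => rfl⟩⟩
  | symm D D' _ ih =>
    obtain ⟨e⟩ := ih
    exact ⟨⟨e.toEquiv.symm, fun a b c => e.toEquiv.symm_apply_eq.2 (by
      refine Eq.trans ?_ (e.map_op _ _ _).symm
      congr 1 <;> exact (e.toEquiv.apply_symm_apply _).symm)⟩⟩
  | trans D D' D'' _ _ ih₁ ih₂ =>
    obtain ⟨e⟩ := ih₁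
    obtain ⟨e'⟩ := ih₂
    exact ⟨⟨e.toEquiv.trans e'.toEquiv, fun a b c =>
      (congrArg e'.toFun (e.map_op a b c)).trans (e'.map_op _ _ _)⟩⟩

theorem SameKnot.nonempty_dehn_iso {D D' : KnotDiagram} (h : SameKnot D D') :
    Nonempty (TernaryIso D.dehnTernaryGroup D'.dehnTernaryGroup) := by
  refine nonempty_iso_of_sameKnot dehnRule (P := fun D => D.dehnTernaryGroup)
    KnotDiagram.represents_dehn ?_ h
  intro s t o u L hD hD' G _ c hc
  obtain ⟨φ, hφ⟩ := exists_region_lift c fun v hv x y h => dehnRule_adj (hc v hv) h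
  have ho : o.1 ∈ Code.ins (.joint (o.1, o.2.2) ::ₘ .joint (u.1, u.2.2) ::ₘ L) := by
    simp [Vertex.passes]
  have hu : u.1 ∈ Code.ins (.joint (o.1, o.2.2) ::ₘ .joint (u.1, u.2.2) ::ₘ L) := by
    simp [Vertex.passes]
  have hcφ : ∀ i (_ : i ∈ Code.ins (.joint (o.1, o.2.2) ::ₘ .joint (u.1, u.2.2) ::ₘ L)) ε,
      φ (hD'.regionAt i ε) = c i ε := fun i hi ε =>
    (congrArg φ (hD'.regionAt_coe ⟨i, hi⟩ ε)).trans (hφ _ _)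
  have key := congrArg φ (region_eq_of_bigon hD hD')
  rw [hcφ _ ho, hcφ _ hu] at key
  obtain rfl | rfl := Int.units_eq_one_or t
  · rw [mul_one] at key
    exact dehnRule_exists_of_eq key
  · rw [mul_neg_one, neg_neg] at key
    -- The case `t = -1` becomes the preceding one after the lower strand is reversed, which changes
    -- the sign of the crossing.
    obtain ⟨x, y, hxy⟩ := dehnRule_exists_of_eq (s := -s) (x := c o.1) (y := dehnRule.rev (c u.1))
      (by simpa [dehnRule] using key)
    have hxy := dehnRule.rev_lower hxy
    rw [neg_neg, dehnRule.rev_rev] at hxy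
    exact ⟨x, _, hxy⟩

theorem SameKnot.nonempty_wirtinger_iso {D D' : KnotDiagram} (h : SameKnot D D') :
    Nonempty (TernaryIso D.wirtingerTernaryGroup D'.wirtingerTernaryGroup) := by
  refine nonempty_iso_of_sameKnot wirtingerRule (P := fun D => D.wirtingerTernaryGroup)
    KnotDiagram.represents_wirtinger ?_ h
  intro s t o u L _ _ G _ c _
  generalize c o.1 = x
  generalize c u.1 = y
  -- No condition on regions arises here: the inner lower color is `y` conjugated by `x`, in the
  -- direction fixed by the sign and by whether the known lower color is incoming or outgoing.
  refine ⟨x, fun _ => if s = t then op (skew (x ())) (y ()) (x ())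
    else op (x ()) (y ()) (skew (x ())), ?_⟩
  obtain rfl | rfl := Int.units_eq_one_or t <;> obtain rfl | rfl := Int.units_eq_one_or s <;>
    simp [wirtingerRule, strandPass]

end TernaryKnot

theorem mainTheorem3 (D D' : TernaryKnot.KnotDiagram) (h : TernaryKnot.SameKnot D D') :
    Nonempty (TernaryKnot.TernaryIso D.dehnTernaryGroup D'.dehnTernaryGroup) ∧
      Nonempty (TernaryKnot.TernaryIso D.wirtingerTernaryGroup D'.wirtingerTernaryGroup) :=
  ⟨h.nonempty_dehn_iso, h.nonempty_wirtinger_iso⟩
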